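/- A chord diagram with $n$ chords is a perfect matching of $2n$ labelled points $1,\dots,2n$ placed in this order on a circle; two chords $\{a,a'\}$ and $\{b,b'\}$ with $a<a'$, $b<b'$ and $a<b$ cross if $a<b<a'<b'$. Let $T_{n,m}$ be the number of chord diagrams with $n$ chords and exactly $m$ pairs of crossing chords (with $T_{0,0}=1$), and let $$T(x,y)=\sum_{n,m\ge 0}T_{n,m}\,x^m y^n$$ as a formal power series. Let $C_n=\frac{1}{n+1}\binom{2n}{n}$ and, for $|x|<1$, let $f(x)=\sum_{j\ge 0}(-1)^j x^{j(j+1)/2}$. Let $\ell\ge 1$ be a fixed integer, let $\omega(n)$ be any real sequence with $\omega(n)\to\infty$ as $n\to\infty$, and let $m=m(n)$ be a sequence of non-negative integers such that, for all sufficiently large $n$, $$m\le \frac{2}{\pi^2}\,n\Bigl(\log n-\tfrac12(\ell+2)\log\log n-\omega(n)\Bigr).$$ Put $q=q(n)=m/(m+n)$. Then, as $n\to\infty$, $$[x^m y^n]\,T(x,y)^{\ell}\;\sim\;\ell\,(2f(q))^{\ell-1}\binom{n+m-1}{n-1}\,C_n\prod_{j\ge 1}(1-q^j)^3 .$$ In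 particular, if $\ell=1$, then $$T_{n,m}\;\sim\;\binom{n+m-1}{n-1}\,C_n\prod_{j\ge 1}(1-q^j)^3 .$$ -/

import Mathlib

/-- A chord diagram with `n` chords: a pairing of the `2 * n` points `0, …, 2 * n - 1`, placed on a
circle in this order, encoded by the fixed-point-free involution that sends each point to the other
end of its chord. -/
abbrev ChordDiagram (n : ℕ) : Type :=
  {σ : Equiv.Perm (Fin (2 * n)) // (∀ i, σ (σ i) = i) ∧ ∀ i, σ i ≠ i}

/-- The number of crossings of a chord diagram, i.e. of unordered pairs of crossing chords. Such a
pair is recorded exactly once, by the smaller ends `a < b` of its two chords `{a, σ a}`, `{b, σ b}`;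
the chords cross when `a < b < σ a < σ b`. -/
def ChordDiagram.crossings {n : ℕ} (D : ChordDiagram n) : ℕ :=
  (Finset.univ.filter fun p : Fin (2 * n) × Fin (2 * n) =>
    p.1 < p.2 ∧ p.2 < D.1 p.1 ∧ D.1 p.1 < D.1 p.2).card

/-- `T_{n,m}`: the number of chord diagrams with `n` chords and `m` crossings. -/
def numChordDiagrams (n m : ℕ) : ℕ :=
  Fintype.card {D : ChordDiagram n // D.crossings = m}

/-- The bivariate generating function `T(x,y) = ∑ T_{n,m} x^m y^n`, as a formal power series in `y`
whose coefficients are formal power series in `x`. -/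
noncomputable def chordSeries : PowerSeries (PowerSeries ℝ) :=
  PowerSeries.mk fun n => PowerSeries.mk fun m => (numChordDiagrams n m : ℝ)

/-- `[x^m y^n] T(x,y)^ℓ`. -/
noncomputable def chordSeriesPowCoeff (ℓ m n : ℕ) : ℝ :=
  PowerSeries.coeff m (PowerSeries.coeff n (chordSeries ^ ℓ))

/-- `f(x) = ∑_{j ≥ 0} (-1)^j x^{j(j+1)/2}`, for `|x| < 1`. -/
noncomputable def altTriangularSeries (x : ℝ) : ℝ :=
  ∑' j : ℕ, (-1 : ℝ) ^ j * x ^ (j * (j + 1) / 2)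

/-- `∏_{j ≥ 1} (1 - x^j)^3`, for `|x| < 1`. -/
noncomputable def eulerProductCubed (x : ℝ) : ℝ :=
  ∏' j : ℕ, (1 - x ^ (j + 1)) ^ 3

/-!
The proof starts from the Touchard–Riordan formula
`(1 - x)^n * ∑_D x^(crossings D) = ∑_j (-1)^j x^(j(j+1)/2) [y^(n-j)] C(y)^(2j+1)`,
where `C` is the generating function of the Catalan numbers
(`one_sub_pow_mul_sum_pow_crossings`). Partial chord diagrams are built point by point: a new point
either opens a chord or closes one of the `h` open chords, and closing the `i`-th open chord from
the right creates `i - 1` crossings. This is a recurrence for the crossing polynomials of partial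
diagrams (`partialCrossingSum_succ`); the same recurrence, up to a power of `1 - x`, is satisfied by
an explicit alternating sum with Gaussian binomial coefficients (`touchardRiordanSum_succ_succ`).

Replacing `y` by `(1 - x) y`, raising to the power `ℓ` and extracting coefficients gives the exact
formula `chordSeriesPowCoeff_eq_sum`: with `J = ∑ p_i` and `K = ∑ p_i (p_i + 1) / 2`,
`[x^m y^n] T^ℓ = ∑_p (-1)^J [y^(n-J)] C(y)^(2J+ℓ) * binom (n - 1 + m - K) (n - 1)`.
Here `[y^(n-J)] C^(2J+ℓ)` is close to `2^(ℓ-1) (2J+ℓ) C_n`, and the binomial coefficient is close to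
`q^K` times its value at `K = 0`; the errors are `1/n` times a polynomial in `K` times a geometric
weight. Summing the main terms, in which `2J + ℓ = ∑ (2 p_i + 1)`, gives
`ℓ f(q)^(ℓ-1) ∑_j (-1)^j (2j+1) q^(j(j+1)/2)`, and the last series is
`∏ (1 - q^j)^3` by Jacobi's identity (`tsum_odd_mul_pow_triangle`), obtained here as the limit of a
finite version. The total error, relative to `binom (n+m-1) (n-1) * C_n`, is
`O((1 - q)^(-(ℓ+5)/2) / n)` uniformly in `m` (`abs_chordSeriesPowCoeff_sub_le`).

It remains to bound the main term from below: `f(q) ≥ 1/3` by a comparison of alternate differences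
(`one_third_le_altTriangularSeries`), and
`∏ (1 - q^j) ≥ exp (-π²/(6(1-q)) - 1/4) (1 - q)^(-1/2)` (`le_qPochhammer`). As
`1 / (1 - q) = 1 + m/n`, the hypothesis on `m` makes the quotient of error and main term
`O(exp (-ω(n)))` (`exp_div_pow_le`).
-/

section

open Finset Filter Topology

/-! ### Recurrence for the crossing polynomials of partial chord diagrams -/

/-- The number of crossings of a partial chord diagram on `N` points. Such a diagram is encoded by
an involution whose fixed points are the starting points of chords that are still open; these
chords end to the right of all `N` points, so that an open chord starting at `b` crosses every
closed chord `{a, σ a}` with `a < b < σ a`. -/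
def partialCrossings {N : ℕ} (σ : Equiv.Perm (Fin N)) : ℕ :=
  ∑ a, ∑ b, if a < b ∧ b < σ a ∧ (σ b = b ∨ σ a < σ b) then 1 else 0

/-- The starting points of the open chords of a partial chord diagram. -/
def openPoints {N : ℕ} (σ : Equiv.Perm (Fin N)) : Finset (Fin N) := {i | σ i = i}

/-- The ways to extend a permutation of the first `N` points to `N + 1` points: `none` fixes the
last point, i.e. opens a chord there, and `some a` interposes it before `a` in its cycle, which for
a fixed point `a` closes the open chord starting at `a`. -/
def addPoint (N : ℕ) : Option (Fin N) × Equiv.Perm (Fin N) ≃ Equiv.Perm (Fin (N + 1)) :=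
  Equiv.Perm.decomposeOption.symm.trans (finSuccEquivLast (n := N)).symm.permCongr

lemma addPoint_none_castSucc {N : ℕ} (σ : Equiv.Perm (Fin N)) (i : Fin N) :
    addPoint N (none, σ) i.castSucc = (σ i).castSucc := by
  simp [addPoint, Equiv.permCongr_apply]

lemma addPoint_none_last {N : ℕ} (σ : Equiv.Perm (Fin N)) :
    addPoint N (none, σ) (Fin.last N) = Fin.last N := by
  simp [addPoint, Equiv.permCongr_apply]

lemma addPoint_some_castSucc {N : ℕ} (a : Fin N) (σ : Equiv.Perm (Fin N)) (i : Fin N) :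
    addPoint N (some a, σ) i.castSucc = if σ i = a then Fin.last N else (σ i).castSucc := by
  simp only [addPoint, Equiv.trans_apply, Equiv.permCongr_apply, Equiv.symm_symm,
    finSuccEquivLast_castSucc, Equiv.Perm.decomposeOption_symm_apply, Equiv.Perm.mul_apply,
    Equiv.optionCongr_apply, Option.map_some]
  split_ifs with h
  · simp [h]
  · rw [Equiv.swap_apply_of_ne_of_ne] <;> simp [h]

lemma addPoint_some_last {N : ℕ} (a : Fin N) (σ : Equiv.Perm (Fin N)) :
    addPoint N (some a, σ) (Fin.last N) = a.castSucc := by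
  simp [addPoint, Equiv.permCongr_apply]

lemma involutive_addPoint_none {N : ℕ} (σ : Equiv.Perm (Fin N)) :
    (∀ i, addPoint N (none, σ) (addPoint N (none, σ) i) = i) ↔ ∀ i, σ (σ i) = i := by
  simp [Fin.forall_fin_succ', addPoint_none_castSucc, addPoint_none_last]

lemma involutive_addPoint_some {N : ℕ} (a : Fin N) (σ : Equiv.Perm (Fin N)) :
    (∀ i, addPoint N (some a, σ) (addPoint N (some a, σ) i) = i) ↔
      (∀ i, σ (σ i) = i) ∧ a ∈ openPoints σ := by
  simp only [Fin.forall_fin_succ', addPoint_some_castSucc, addPoint_some_last, openPoints,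
    mem_filter, mem_univ, true_and]
  constructor
  · rintro ⟨h, h'⟩
    have ha : σ a = a := by
      by_contra hne
      rw [if_neg hne] at h'
      exact Fin.castSucc_ne_last _ h'
    refine ⟨fun i => ?_, ha⟩
    have := h i
    split_ifs at this with h1
    · rw [addPoint_some_last, Fin.castSucc_inj] at this
      rw [h1, ha, this]
    · rw [addPoint_some_castSucc] at this
      split_ifs at this with h2
      · exact absurd this.symm (Fin.castSucc_ne_last _)
      · exact Fin.castSucc_inj.1 this
  · rintro ⟨h, ha⟩
    refine ⟨fun i => ?_, by simp [ha]⟩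
    split_ifs with h1
    · rw [addPoint_some_last, ← h i, h1, ha]
    · have : i ≠ a := fun hia => h1 (hia ▸ ha)
      rw [addPoint_some_castSucc, h, if_neg this]

lemma card_openPoints_addPoint_none {N : ℕ} (σ : Equiv.Perm (Fin N)) :
    (openPoints (addPoint N (none, σ))).card = (openPoints σ).card + 1 := by
  simp only [openPoints, card_filter, Fin.sum_univ_castSucc, addPoint_none_castSucc,
    addPoint_none_last, Fin.castSucc_inj, if_true]

lemma card_openPoints_addPoint_some {N : ℕ} (a : Fin N) (σ : Equiv.Perm (Fin N))
    (ha : a ∈ openPoints σ) :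
    (openPoints (addPoint N (some a, σ))).card + 1 = (openPoints σ).card := by
  have h : (openPoints (addPoint N (some a, σ))).card = ((openPoints σ).erase a).card := by
    simp only [openPoints, mem_filter, mem_univ, true_and] at ha
    have : (openPoints σ).erase a = ({i | i ≠ a ∧ σ i = i} : Finset (Fin N)) := by
      ext i; simp [openPoints]
    rw [this]
    simp only [openPoints, card_filter, Fin.sum_univ_castSucc, addPoint_some_castSucc,
      addPoint_some_last, Fin.castSucc_ne_last, if_false, add_zero]
    refine sum_congr rfl fun i _ => if_congr ?_ rfl rfl
    split_ifs with h1
    · have : i = a := σ.injective (h1.trans ha.symm)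
      simp [this, (Fin.castSucc_ne_last a).symm]
    · have : i ≠ a := fun hia => h1 (hia ▸ ha)
      simp [this]
  rw [h, card_erase_add_one ha]

lemma partialCrossings_addPoint_none {N : ℕ} (σ : Equiv.Perm (Fin N)) :
    partialCrossings (addPoint N (none, σ)) = partialCrossings σ := by
  simp only [partialCrossings, Fin.sum_univ_castSucc, addPoint_none_castSucc,
    addPoint_none_last, Fin.castSucc_inj, Fin.castSucc_lt_castSucc_iff]
  simp [Fin.not_lt.2 (Fin.le_last _)]

/-- Closing the chord that starts at the open point `a` creates one crossing with each chord that
starts at an open point to the right of `a`. -/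
lemma partialCrossings_addPoint_some {N : ℕ} (a : Fin N) (σ : Equiv.Perm (Fin N))
    (ha : a ∈ openPoints σ) :
    partialCrossings (addPoint N (some a, σ)) =
      partialCrossings σ + ((openPoints σ).filter (a < ·)).card := by
  simp only [openPoints, mem_filter, mem_univ, true_and] at ha
  have hσ : ∀ i, σ i = a ↔ i = a := fun i =>
    ⟨fun h => σ.injective (h.trans ha.symm), fun h => h ▸ ha⟩
  have key : ∀ i j : Fin N,
      (if i.castSucc < j.castSucc ∧ j.castSucc < addPoint N (some a, σ) i.castSucc ∧
        (addPoint N (some a, σ) j.castSucc = j.castSucc ∨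
          addPoint N (some a, σ) i.castSucc < addPoint N (some a, σ) j.castSucc) then 1 else 0) =
      (if i < j ∧ j < σ i ∧ (σ j = j ∨ σ i < σ j) then 1 else 0) +
        if i = a then (if a < j ∧ σ j = j then 1 else 0) else 0 := by
    intro i j
    simp only [addPoint_some_castSucc, hσ]
    by_cases hi : i = a
    · subst hi
      by_cases hj : j = i
      · simp [hj]
      · have h1 : ¬ (i < j ∧ j < σ i ∧ (σ j = j ∨ σ i < σ j)) := by
          rw [ha]; exact fun h => absurd h.1 (not_lt.2 h.2.1.le)
        simp [hj, h1, Fin.castSucc_lt_last, Fin.not_lt.2 (Fin.le_last _)]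
    · by_cases hj : j = a
      · subst hj
        simp [hi, ha, Fin.castSucc_lt_last]
      · simp [hi, hj]
  have hlast : ∀ b, ¬ (Fin.last N < b) := fun b => Fin.not_lt.2 (Fin.le_last _)
  simp only [partialCrossings, Fin.sum_univ_castSucc (n := N), key, hlast, false_and, and_false,
    if_false, sum_const_zero, add_zero, sum_add_distrib, addPoint_some_last]
  congr 1
  rw [sum_comm]
  simp only [openPoints, filter_filter, card_filter, sum_ite_eq', mem_univ, if_true]
  simp only [and_comm]

/-- The sum over the open chords that can be closed, weighted by the crossings that this creates. -/
lemma sum_pow_card_filter_gt {α R : Type*} [LinearOrder α] [CommSemiring R] (x : R)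
    (s : Finset α) :
    ∑ a ∈ s, x ^ (s.filter (a < ·)).card = ∑ i ∈ range s.card, x ^ i := by
  induction s using Finset.induction_on_min with
  | empty => simp
  | insert a s ha ih =>
    have has : a ∉ s := fun h => lt_irrefl _ (ha a h)
    rw [sum_insert has, card_insert_of_notMem has, sum_range_succ, ← ih, add_comm]
    congr 1
    · refine sum_congr rfl fun b hb => ?_
      rw [filter_insert, if_neg (not_lt.2 (ha b hb).le)]
    · rw [filter_insert, if_neg (lt_irrefl _), filter_true_of_mem ha]

section
variable {R : Type*} [CommRing R]

/-- The crossing polynomial, evaluated at `x`, of the partial chord diagrams on `N` points with `h`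
open chords. -/
def partialCrossingSum (x : R) (N h : ℕ) : R :=
  ∑ σ : Equiv.Perm (Fin N) with (∀ i, σ (σ i) = i) ∧ (openPoints σ).card = h,
    x ^ partialCrossings σ

lemma partialCrossingSum_succ (x : R) (N h : ℕ) :
    partialCrossingSum x (N + 1) h =
      (∑ σ : Equiv.Perm (Fin N) with (∀ i, σ (σ i) = i) ∧ (openPoints σ).card + 1 = h,
        x ^ partialCrossings σ) +
      (∑ i ∈ range (h + 1), x ^ i) * partialCrossingSum x N (h + 1) := by
  simp only [partialCrossingSum, sum_filter]
  rw [← (addPoint N).sum_comp, Fintype.sum_prod_type, Fintype.sum_option]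
  congr 1
  · simp only [involutive_addPoint_none, card_openPoints_addPoint_none,
      partialCrossings_addPoint_none]
  · rw [sum_comm, mul_sum]
    refine sum_congr rfl fun σ _ => ?_
    simp only [involutive_addPoint_some]
    by_cases hσ : ∀ i, σ (σ i) = i
    swap
    · simp [hσ]
    have : ∀ a, (if ((∀ i, σ (σ i) = i) ∧ a ∈ openPoints σ) ∧
        (openPoints (addPoint N (some a, σ))).card = h then
          x ^ partialCrossings (addPoint N (some a, σ)) else 0) =
        if a ∈ openPoints σ then (if (openPoints σ).card = h + 1 then
          x ^ partialCrossings σ * x ^ ((openPoints σ).filter (a < ·)).card else 0) else 0 := by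
      intro a
      by_cases ha : a ∈ openPoints σ
      · have := card_openPoints_addPoint_some a σ ha
        rw [partialCrossings_addPoint_some a σ ha, pow_add]
        simp only [hσ, ha, implies_true, true_and, if_true]
        refine if_congr ⟨by omega, by omega⟩ rfl rfl
      · simp [ha]
    simp only [this, sum_ite_mem, univ_inter]
    by_cases hc : (openPoints σ).card = h + 1
    · simp only [hc, if_true, ← mul_sum, sum_pow_card_filter_gt, hσ, implies_true, and_self]
      ring
    · simp [hc]

lemma partialCrossingSum_succ_zero (x : R) (N : ℕ) :
    partialCrossingSum x (N + 1) 0 = partialCrossingSum x N 1 := by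
  rw [partialCrossingSum_succ]; simp

lemma partialCrossingSum_succ_succ (x : R) (N h : ℕ) :
    partialCrossingSum x (N + 1) (h + 1) = partialCrossingSum x N h +
      (∑ i ∈ range (h + 2), x ^ i) * partialCrossingSum x N (h + 2) := by
  rw [partialCrossingSum_succ]
  simp only [add_left_inj, partialCrossingSum]

lemma partialCrossingSum_eq_zero (x : R) {N h : ℕ} (hN : N < h) :
    partialCrossingSum x N h = 0 := by
  rw [partialCrossingSum, filter_false_of_mem, sum_empty]
  rintro σ - ⟨-, hc⟩
  have := card_le_univ (openPoints σ)
  simp at this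
  omega

lemma partialCrossingSum_zero_zero (x : R) : partialCrossingSum x 0 0 = 1 := by
  simp [partialCrossingSum, openPoints, partialCrossings, filter_true_of_mem]

lemma sum_pow_crossings (x : R) (n : ℕ) :
    ∑ D : ChordDiagram n, x ^ D.crossings = partialCrossingSum x (2 * n) 0 := by
  rw [partialCrossingSum, sum_subtype (p := fun σ : Equiv.Perm (Fin (2 * n)) =>
    (∀ i, σ (σ i) = i) ∧ ∀ i, σ i ≠ i) _ (fun σ => by simp [openPoints, filter_eq_empty_iff])
    (fun σ => x ^ partialCrossings σ)]
  refine sum_congr rfl fun D _ => ?_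
  have := D.2.2
  simp only [ChordDiagram.crossings, partialCrossings, card_filter, Fintype.sum_prod_type, this,
    false_or]

end

/-! ### Gaussian binomial coefficients and the Touchard–Riordan formula -/

section
variable {R : Type*} [CommRing R]

/-- The Gaussian binomial coefficient `[a+b choose a]_x`, defined by one of its two Pascal
recurrences. -/
def gaussBinom (x : R) : ℕ → ℕ → R
  | 0, _ => 1
  | _ + 1, 0 => 1
  | a + 1, b + 1 => gaussBinom x a (b + 1) + x ^ (a + 1) * gaussBinom x (a + 1) b

@[simp] lemma gaussBinom_zero_left (x : R) (b : ℕ) : gaussBinom x 0 b = 1 := by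
  simp [gaussBinom]

@[simp] lemma gaussBinom_zero_right (x : R) (a : ℕ) : gaussBinom x a 0 = 1 := by
  cases a <;> simp [gaussBinom]

lemma gaussBinom_succ_succ (x : R) (a b : ℕ) :
    gaussBinom x (a + 1) (b + 1) =
      gaussBinom x a (b + 1) + x ^ (a + 1) * gaussBinom x (a + 1) b := by
  rw [gaussBinom]

/-- The other Pascal recurrence. -/
lemma gaussBinom_succ_succ' (x : R) (a b : ℕ) :
    gaussBinom x (a + 1) (b + 1) =
      x ^ (b + 1) * gaussBinom x a (b + 1) + gaussBinom x (a + 1) b := by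
  have H : ∀ s a b : ℕ, a + b = s → gaussBinom x (a + 1) (b + 1) =
      x ^ (b + 1) * gaussBinom x a (b + 1) + gaussBinom x (a + 1) b := by
    intro s
    induction s with
    | zero =>
      intro a b h
      obtain ⟨rfl, rfl⟩ : a = 0 ∧ b = 0 := by omega
      simp [gaussBinom]; ring
    | succ s ih =>
      intro a b h
      rw [gaussBinom_succ_succ]
      rcases a with _ | a
      · rcases b with _ | b
        · simp; ring
        · have h1 := ih 0 b (by omega)
          have h2 := gaussBinom_succ_succ x 0 b
          simp only [gaussBinom_zero_left] at h1 h2 ⊢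
          linear_combination (x ^ (0 + 1)) * h1 - h2
      · rcases b with _ | b
        · have h1 := ih a 0 (by omega)
          have h2 := gaussBinom_succ_succ x a 0
          simp only [gaussBinom_zero_right] at h1 h2 ⊢
          linear_combination h1 - x ^ (0 + 1) * h2
        · have h1 := ih a (b + 1) (by omega)
          have h2 := ih (a + 1) b (by omega)
          have h3 := gaussBinom_succ_succ x a (b + 1)
          have h4 := gaussBinom_succ_succ x (a + 1) b
          linear_combination h1 + x ^ (a + 1 + 1) * h2 - x ^ (b + 1 + 1) * h3 - h4
  exact H _ a b rfl

/-- The difference of the two Pascal recurrences. -/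
lemma one_sub_pow_mul_gaussBinom (x : R) (a b : ℕ) :
    (1 - x ^ (a + 1)) * gaussBinom x (a + 1) b = (1 - x ^ (b + 1)) * gaussBinom x a (b + 1) := by
  have h1 := gaussBinom_succ_succ x a b
  have h2 := gaussBinom_succ_succ' x a b
  linear_combination h1 - h2

/-- The coefficient `[y^k] C(y)^r`, where `C` is the generating function of the Catalan numbers; the
recurrence is `C^(r+1) = C^r + y C^(r+2)`. See `coeff_catalanGF_pow`. -/
def catalanPow : ℕ → ℕ → ℕ
  | _, 0 => 1
  | 0, _ + 1 => 0
  | r + 1, k + 1 => catalanPow r (k + 1) + catalanPow (r + 2) k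
termination_by r k => (k, r)

lemma catalanPow_zero_right (r : ℕ) : catalanPow r 0 = 1 := by
  cases r <;> simp [catalanPow]

lemma catalanPow_zero_succ (k : ℕ) : catalanPow 0 (k + 1) = 0 := by
  simp [catalanPow]

lemma catalanPow_succ_succ (r k : ℕ) :
    catalanPow (r + 1) (k + 1) = catalanPow r (k + 1) + catalanPow (r + 2) k := by
  rw [catalanPow]

/-- The sum that equals `(1 - x)^d` times the crossing polynomial of the partial chord diagrams with
`d` closed and `h` open chords, see `one_sub_pow_mul_partialCrossingSum`. -/
def touchardRiordanSum (x : R) (d h : ℕ) : R :=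
  ∑ j ∈ range (d + 1), (-1) ^ j * x ^ (j * (j + 1) / 2) * gaussBinom x h j *
    catalanPow (h + 2 * j + 1) (d - j)

lemma touchardRiordanSum_zero (x : R) (h : ℕ) : touchardRiordanSum x 0 h = 1 := by
  simp [touchardRiordanSum, catalanPow_zero_right]

lemma triangle_succ (j : ℕ) : (j + 1) * (j + 1 + 1) / 2 = j * (j + 1) / 2 + (j + 1) := by
  rw [show (j + 1) * (j + 1 + 1) = j * (j + 1) + (j + 1) * 2 by ring,
    Nat.add_mul_div_right _ _ two_pos]

/-- Expanding each `C^(h+2j+1)` as `C^(h+2j) + y C^(h+2j+2)` and collecting equal powers of `C`. -/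
lemma touchardRiordanSum_succ_split (x : R) (d h : ℕ) :
    touchardRiordanSum x (d + 1) h =
      catalanPow h (d + 1) +
      ∑ j ∈ range (d + 1), (-1) ^ j * x ^ (j * (j + 1) / 2) *
        (gaussBinom x h j - x ^ (j + 1) * gaussBinom x h (j + 1)) *
          catalanPow (h + 2 * j + 2) (d - j) := by
  have hsplit : touchardRiordanSum x (d + 1) h =
      (∑ j ∈ range (d + 2), (-1) ^ j * x ^ (j * (j + 1) / 2) * gaussBinom x h j *
        catalanPow (h + 2 * j) (d + 1 - j)) +
      ∑ j ∈ range (d + 1), (-1) ^ j * x ^ (j * (j + 1) / 2) * gaussBinom x h j *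
        catalanPow (h + 2 * j + 2) (d - j) := by
    have hS : ∑ j ∈ range (d + 1), (-1) ^ j * x ^ (j * (j + 1) / 2) * gaussBinom x h j *
          catalanPow (h + 2 * j + 1) (d + 1 - j) =
        ∑ j ∈ range (d + 1), (-1) ^ j * x ^ (j * (j + 1) / 2) * gaussBinom x h j *
          catalanPow (h + 2 * j) (d + 1 - j) +
        ∑ j ∈ range (d + 1), (-1) ^ j * x ^ (j * (j + 1) / 2) * gaussBinom x h j *
          catalanPow (h + 2 * j + 2) (d - j) := by
      rw [← sum_add_distrib]
      refine sum_congr rfl fun j hj => ?_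
      rw [mem_range] at hj
      rw [show d + 1 - j = d - j + 1 by omega, catalanPow_succ_succ]
      push_cast
      ring
    rw [touchardRiordanSum, sum_range_succ _ (d + 1), sum_range_succ _ (d + 1), hS]
    simp only [Nat.sub_self, catalanPow_zero_right, Nat.cast_one]
    ring
  rw [hsplit, sum_range_succ', add_right_comm, ← sum_add_distrib, add_comm]
  congr 1
  · simp
  · refine sum_congr rfl fun j hj => ?_
    rw [show h + 2 * (j + 1) = h + 2 * j + 2 by ring, show d + 1 - (j + 1) = d - j by omega,
      triangle_succ, pow_add, pow_succ (-1 : R)]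
    ring

lemma touchardRiordanSum_succ_zero (x : R) (d : ℕ) :
    touchardRiordanSum x (d + 1) 0 = (1 - x) * touchardRiordanSum x d 1 := by
  rw [touchardRiordanSum_succ_split, catalanPow_zero_succ, Nat.cast_zero, zero_add,
    touchardRiordanSum, mul_sum]
  refine sum_congr rfl fun j _ => ?_
  have := one_sub_pow_mul_gaussBinom x 0 j
  simp only [zero_add, pow_one, gaussBinom_zero_left, mul_one] at this ⊢
  rw [show 2 * j + 2 = 1 + 2 * j + 1 by ring]
  linear_combination
    (-((-1) ^ j * x ^ (j * (j + 1) / 2) * catalanPow (1 + 2 * j + 1) (d - j))) * this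

lemma touchardRiordanSum_succ_succ (x : R) (d h : ℕ) :
    touchardRiordanSum x (d + 1) (h + 1) = touchardRiordanSum x (d + 1) h +
      (1 - x ^ (h + 2)) * touchardRiordanSum x d (h + 2) := by
  have h0 : touchardRiordanSum x (d + 1) h = catalanPow (h + 1) (d + 1) +
      ∑ j ∈ range (d + 1), (-1) ^ (j + 1) * x ^ ((j + 1) * (j + 1 + 1) / 2) *
        gaussBinom x h (j + 1) * catalanPow (h + 2 * (j + 1) + 1) (d + 1 - (j + 1)) := by
    rw [touchardRiordanSum, sum_range_succ', add_comm]
    simp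
  rw [touchardRiordanSum_succ_split, h0, touchardRiordanSum, mul_sum, add_assoc, ← sum_add_distrib]
  congr 1
  refine sum_congr rfl fun j _ => ?_
  have h1 := one_sub_pow_mul_gaussBinom x (h + 1) j
  have h2 := gaussBinom_succ_succ' x h j
  rw [show h + 2 * (j + 1) + 1 = h + 2 * j + 3 by ring, show d + 1 - (j + 1) = d - j by omega,
    show h + 1 + 2 * j + 2 = h + 2 * j + 3 by ring, show h + 2 + 2 * j + 1 = h + 2 * j + 3 by ring,
    triangle_succ, pow_add, pow_succ (-1 : R)]
  linear_combination (-((-1) ^ j * x ^ (j * (j + 1) / 2) * catalanPow (h + 2 * j + 3) (d - j))) *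
    (h1 + h2)

/-- The Touchard–Riordan formula for partial chord diagrams with `d` closed and `h` open chords. -/
theorem one_sub_pow_mul_partialCrossingSum (x : R) (d h : ℕ) :
    (1 - x) ^ d * partialCrossingSum x (h + 2 * d) h = touchardRiordanSum x d h := by
  have H : ∀ N d h : ℕ, h + 2 * d = N →
      (1 - x) ^ d * partialCrossingSum x N h = touchardRiordanSum x d h := by
    intro N
    induction N with
    | zero =>
      intro d h hN
      obtain ⟨rfl, rfl⟩ : d = 0 ∧ h = 0 := by omega
      simp [touchardRiordanSum_zero, partialCrossingSum_zero_zero]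
    | succ N ih =>
      intro d h hN
      have hgeom : ∀ k, (1 - x) * ∑ i ∈ range k, x ^ i = 1 - x ^ k := mul_neg_geom_sum x
      rcases h with _ | h
      · obtain ⟨d, rfl⟩ : ∃ d', d = d' + 1 := ⟨d - 1, by omega⟩
        rw [partialCrossingSum_succ_zero, touchardRiordanSum_succ_zero, ← ih d 1 (by omega)]
        ring
      · rw [partialCrossingSum_succ_succ, mul_add, ih d h (by omega)]
        rcases d with _ | d
        · rw [partialCrossingSum_eq_zero x (show N < h + 2 by omega)]
          simp [touchardRiordanSum_zero]
        · rw [touchardRiordanSum_succ_succ, ← ih d (h + 2) (by omega), ← hgeom]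
          ring
  exact H _ d h rfl

/-- The **Touchard–Riordan formula**. -/
theorem one_sub_pow_mul_sum_pow_crossings (x : R) (n : ℕ) :
    (1 - x) ^ n * ∑ D : ChordDiagram n, x ^ D.crossings =
      ∑ j ∈ range (n + 1), (-1) ^ j * x ^ (j * (j + 1) / 2) * catalanPow (2 * j + 1) (n - j) := by
  have := one_sub_pow_mul_partialCrossingSum x n 0
  rw [zero_add] at this
  rw [sum_pow_crossings, this, touchardRiordanSum]
  simp

end

/-! ### An exact formula for the coefficients of the powers of the chord series -/

section
variable {R : Type*} [CommRing R]

/-- The generating function of the Catalan numbers, with coefficients in `R`. -/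
noncomputable def catalanGF (R : Type*) [CommRing R] : PowerSeries R :=
  PowerSeries.catalanSeries.map (Nat.castRingHom R)

lemma catalanGF_eq : catalanGF R = catalanGF R ^ 2 * PowerSeries.X + 1 := by
  have := congrArg (PowerSeries.map (Nat.castRingHom R)) PowerSeries.catalanSeries_sq_mul_X_add_one
  simp only [map_add, map_mul, map_pow, PowerSeries.map_X, map_one] at this
  exact this.symm

lemma coeff_catalanGF_pow (r k : ℕ) :
    PowerSeries.coeff k (catalanGF R ^ r) = (catalanPow r k : R) := by
  induction k generalizing r with
  | zero =>
    rw [PowerSeries.coeff_zero_eq_constantCoeff_apply, map_pow, catalanPow_zero_right]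
    have : PowerSeries.constantCoeff (catalanGF R) = 1 := by
      rw [catalanGF_eq]; simp
    simp [this]
  | succ k ihk =>
    induction r with
    | zero => simp [catalanPow_zero_succ, PowerSeries.coeff_one]
    | succ r ihr =>
      have : catalanGF R ^ (r + 1) = catalanGF R ^ r + catalanGF R ^ (r + 2) * PowerSeries.X := by
        calc catalanGF R ^ (r + 1) = catalanGF R ^ r * catalanGF R := pow_succ _ _
          _ = catalanGF R ^ r * (catalanGF R ^ 2 * PowerSeries.X + 1) := by rw [← catalanGF_eq]
          _ = _ := by ring
      rw [this, map_add, ihr, PowerSeries.coeff_succ_mul_X, ihk, catalanPow_succ_succ]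
      push_cast
      ring

lemma catalanPow_one (k : ℕ) : catalanPow 1 k = catalan k := by
  have := coeff_catalanGF_pow (R := ℤ) 1 k
  rw [pow_one, catalanGF, PowerSeries.coeff_map, PowerSeries.catalanSeries_coeff] at this
  simpa using this.symm

end

open PowerSeries in
lemma mk_numChordDiagrams (n : ℕ) :
    (PowerSeries.mk fun m => (numChordDiagrams n m : ℝ)) =
      ∑ D : ChordDiagram n, (X : PowerSeries ℝ) ^ D.crossings := by
  ext m
  simp only [coeff_mk, map_sum, coeff_X_pow, numChordDiagrams, Fintype.card_subtype, sum_boole]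
  simp [eq_comm]

open PowerSeries in
/-- The first `N` terms of the series `∑_j (-1)^j x^(j(j+1)/2) y^j C(y)^(2j+1)`, which by the
Touchard–Riordan formula represents `T(x, (1 - x) y)`. The truncation keeps all sums finite. -/
noncomputable def chordSum (N : ℕ) : PowerSeries (PowerSeries ℝ) :=
  ∑ j ∈ range N, C ((-1) ^ j * X ^ (j * (j + 1) / 2)) * (X ^ j * catalanGF _ ^ (2 * j + 1))

open PowerSeries in
lemma coeff_rescale_chordSeries {n N : ℕ} (h : n < N) :
    coeff n (rescale (1 - X) chordSeries) = coeff n (chordSum N) := by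
  rw [coeff_rescale, chordSeries, coeff_mk, mk_numChordDiagrams, one_sub_pow_mul_sum_pow_crossings,
    chordSum, map_sum]
  obtain ⟨k, rfl⟩ : ∃ k, N = (n + 1) + k := ⟨N - (n + 1), by omega⟩
  rw [sum_range_add _ (n + 1) k, sum_eq_zero (s := range k), add_zero]
  · refine sum_congr rfl fun j hj => ?_
    rw [mem_range] at hj
    rw [coeff_C_mul, coeff_X_pow_mul', if_pos (by omega), coeff_catalanGF_pow]
  · intro j _
    rw [coeff_C_mul, coeff_X_pow_mul', if_neg (by omega), mul_zero]

open PowerSeries in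
lemma coeff_eq_of_forall_lt {R : Type*} [CommRing R] {f g : PowerSeries R} {N : ℕ}
    (h : ∀ n < N, coeff n f = coeff n g) (ℓ : ℕ) {n : ℕ} (hn : n < N) :
    coeff n (f ^ ℓ) = coeff n (g ^ ℓ) := by
  have h1 : (X : PowerSeries R) ^ N ∣ f - g :=
    X_pow_dvd_iff.2 fun k hk => by rw [map_sub, h k hk, sub_self]
  have h2 := X_pow_dvd_iff.1 (h1.trans (sub_dvd_pow_sub_pow f g ℓ)) n hn
  rwa [map_sub, sub_eq_zero] at h2

/-- The sum of the triangular numbers `p_i (p_i + 1) / 2`; the divisions in `ℕ` are exact. -/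
def triangleSum {ℓ : ℕ} (p : Fin ℓ → ℕ) : ℕ := ∑ i, p i * (p i + 1) / 2

/-- The coefficient `[y^n] y^J C(y)^(2J+ℓ)`. -/
def shiftedCatalanPow (ℓ n J : ℕ) : ℕ := if J ≤ n then catalanPow (2 * J + ℓ) (n - J) else 0

open PowerSeries in
lemma coeff_chordSum_pow (ℓ n N : ℕ) :
    coeff n (chordSum N ^ ℓ) = ∑ p ∈ Fintype.piFinset fun _ : Fin ℓ => range N,
      (-1 : PowerSeries ℝ) ^ (∑ i, p i) * X ^ triangleSum p *
        (shiftedCatalanPow ℓ n (∑ i, p i) : PowerSeries ℝ) := by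
  have h : chordSum N ^ ℓ = ∏ _i : Fin ℓ, chordSum N := by simp
  rw [h, chordSum, prod_univ_sum, map_sum]
  refine sum_congr rfl fun p _ => ?_
  have h2 : ∏ i, (C ((-1) ^ p i * X ^ (p i * (p i + 1) / 2)) *
      (X ^ p i * catalanGF (PowerSeries ℝ) ^ (2 * p i + 1))) =
      C ((-1) ^ (∑ i, p i) * X ^ triangleSum p) *
        (X ^ (∑ i, p i) * catalanGF (PowerSeries ℝ) ^ (2 * (∑ i, p i) + ℓ)) := by
    simp only [prod_mul_distrib, ← map_prod, prod_pow_eq_pow_sum, triangleSum, sum_add_distrib,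
      ← mul_sum]
    simp
  rw [h2, coeff_C_mul, coeff_X_pow_mul', shiftedCatalanPow]
  split_ifs with hJ
  · rw [coeff_catalanGF_pow]
  · simp

/-- The coefficient `[x^m] x^K (1 - x)^(-n)`, for `n ≥ 1`. -/
def shiftedChoose (n m K : ℕ) : ℕ := if K ≤ m then Nat.choose (n - 1 + (m - K)) (n - 1) else 0

open PowerSeries in
/-- The exact formula: the coefficient of `y^n` does not depend on the truncation order `N > n`. -/
theorem chordSeriesPowCoeff_eq_sum (ℓ m : ℕ) {n N : ℕ} (hn : 1 ≤ n) (hN : n < N) :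
    chordSeriesPowCoeff ℓ m n = ∑ p ∈ Fintype.piFinset fun _ : Fin ℓ => range N,
      (-1 : ℝ) ^ (∑ i, p i) * (shiftedCatalanPow ℓ n (∑ i, p i) : ℝ) *
        (shiftedChoose n m (triangleSum p) : ℝ) := by
  have h1 : (1 - X : PowerSeries ℝ) ^ n * coeff n (chordSeries ^ ℓ) = coeff n (chordSum N ^ ℓ) := by
    rw [← coeff_eq_of_forall_lt (fun k hk => coeff_rescale_chordSeries hk) ℓ hN, ← map_pow,
      coeff_rescale]
  set G : PowerSeries ℝ := PowerSeries.mk fun k => (Nat.choose (n - 1 + k) (n - 1) : ℝ) with hG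
  have hG1 : G * (1 - X) ^ n = 1 := by
    have := mk_add_choose_mul_one_sub_pow_eq_one ℝ (n - 1)
    rwa [Nat.sub_add_cancel hn] at this
  have h2 : coeff n (chordSeries ^ ℓ) = G * coeff n (chordSum N ^ ℓ) := by
    rw [← h1, ← mul_assoc, hG1, one_mul]
  rw [chordSeriesPowCoeff, h2, coeff_chordSum_pow, mul_sum, map_sum]
  refine sum_congr rfl fun p _ => ?_
  have h3 : G * ((-1 : PowerSeries ℝ) ^ (∑ i, p i) * X ^ triangleSum p *
        (shiftedCatalanPow ℓ n (∑ i, p i) : PowerSeries ℝ)) =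
      C ((-1 : ℝ) ^ (∑ i, p i) * (shiftedCatalanPow ℓ n (∑ i, p i) : ℝ)) *
        (G * X ^ triangleSum p) := by
    simp only [map_mul, map_pow, map_neg, map_one, map_natCast]
    ring
  rw [h3, coeff_C_mul, coeff_mul_X_pow', shiftedChoose]
  split_ifs
  · rw [hG, coeff_mk]
  · simp

/-! ### A lower bound for the Euler product -/

/-- The finite Euler product `(q; q)_n = (1 - q) (1 - q^2) ⋯ (1 - q^n)`. -/
def qPochhammer {R : Type*} [CommRing R] (q : R) (n : ℕ) : R := ∏ i ∈ range n, (1 - q ^ (i + 1))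

lemma exp_neg_div_one_sub_le {x : ℝ} (hx : 0 < x) :
    Real.exp (-x) / (1 - Real.exp (-x)) ≤ 1 / x - 1 / 2 + x / 4 ∧
      Real.exp (-x) / (1 - Real.exp (-x)) ≤ 1 / x := by
  have h1 := Real.quadratic_le_exp_of_nonneg hx.le
  have hpos : 0 < x * (1 + x / 2) := by positivity
  have h2 : Real.exp (-x) / (1 - Real.exp (-x)) = 1 / (Real.exp x - 1) := by
    rw [Real.exp_neg, div_eq_div_iff]
    · field_simp
    · have : (Real.exp x)⁻¹ < 1 := inv_lt_one_of_one_lt₀ (by nlinarith)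
      linarith
    · nlinarith
  have h3 : 1 / (Real.exp x - 1) ≤ 1 / (x * (1 + x / 2)) :=
    one_div_le_one_div_of_le hpos (by nlinarith)
  rw [h2]
  constructor
  · refine h3.trans ?_
    rw [div_le_iff₀ hpos]
    have : (1 / x - 1 / 2 + x / 4) * (x * (1 + x / 2)) = 1 + x ^ 3 / 8 := by field_simp; ring
    rw [this]
    have : 0 < x ^ 3 := by positivity
    linarith
  · exact h3.trans (one_div_le_one_div_of_le hx (by nlinarith))

/-- Expanding the logarithms and summing over `i` first leaves `∑_k 1 / (k (exp (k δ) - 1))`. The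
terms `1 / (k² δ)` give `π² / (6 δ)`; for `k ≤ 1 / δ` the correction `-1/2 + k δ / 4` to
`1 / (k δ)` contributes minus half a harmonic sum, at most `log δ / 2`, and a bounded rest. -/
lemma sum_neg_log_one_sub_exp_le {δ : ℝ} (hδ : 0 < δ) (N : ℕ) :
    ∑ i ∈ range N, -Real.log (1 - Real.exp (-(δ * (i + 1)))) ≤
      Real.pi ^ 2 / (6 * δ) + 1 / 2 * Real.log δ + 1 / 4 := by
  set K := ⌊1 / δ⌋₊ with hK
  have hL : HasSum (fun k : ℕ => ∑ i ∈ range N, Real.exp (-(δ * (i + 1))) ^ (k + 1) / ((k : ℝ) + 1))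
      (∑ i ∈ range N, -Real.log (1 - Real.exp (-(δ * (i + 1))))) := by
    refine hasSum_sum fun i _ => Real.hasSum_pow_div_log_of_abs_lt_one ?_
    rw [abs_of_pos (Real.exp_pos _), Real.exp_lt_one_iff]
    have : 0 < δ * ((i : ℝ) + 1) := by positivity
    linarith
  have hR1 : HasSum (fun k : ℕ => 1 / ((k : ℝ) + 1) ^ 2 * (1 / δ)) (Real.pi ^ 2 / 6 * (1 / δ)) := by
    have := (hasSum_nat_add_iff' 1).2 hasSum_zeta_two
    simpa using this.mul_right (1 / δ)
  have hR2 : HasSum (fun k : ℕ => if k ∈ range K then -(1 / 2 * ((k : ℝ) + 1)⁻¹) + δ / 4 else 0)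
      (∑ k ∈ range K, if k ∈ range K then -(1 / 2 * ((k : ℝ) + 1)⁻¹) + δ / 4 else 0) :=
    hasSum_sum_of_ne_finset_zero fun k hk => by rw [if_neg hk]
  have hle := hasSum_le (fun k => ?_) hL (hR1.add hR2)
  · refine hle.trans ?_
    rw [sum_congr rfl fun k hk => if_pos hk, sum_add_distrib, sum_neg_distrib, ← mul_sum, sum_const,
      card_range, nsmul_eq_mul]
    have h1 : Real.log (1 / δ) ≤ ∑ k ∈ range K, ((k : ℝ) + 1)⁻¹ := by
      have h2 := log_add_one_le_harmonic K
      have h3 : Real.log (1 / δ) ≤ Real.log ((K + 1 : ℕ) : ℝ) :=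
        Real.log_le_log (by positivity) (by push_cast; exact (Nat.lt_floor_add_one _).le)
      refine h3.trans (h2.trans (le_of_eq ?_))
      simp [harmonic]
    have h2 : (K : ℝ) * δ ≤ 1 := by
      rw [← le_div_iff₀ hδ]; exact Nat.floor_le (by positivity)
    rw [one_div, Real.log_inv] at h1
    have h4 : Real.pi ^ 2 / 6 * (1 / δ) = Real.pi ^ 2 / (6 * δ) := by field_simp
    rw [h4]
    linarith
  · rw [← sum_div]
    set x := δ * ((k : ℝ) + 1) with hx
    have hx0 : 0 < x := by positivity
    have hk0 : (0 : ℝ) < k + 1 := by positivity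
    have hy : Real.exp (-x) < 1 := by rw [Real.exp_lt_one_iff]; linarith
    have h1 : ∑ i ∈ range N, Real.exp (-(δ * ((i : ℝ) + 1))) ^ (k + 1) ≤
        Real.exp (-x) / (1 - Real.exp (-x)) := by
      have : ∀ i : ℕ, Real.exp (-(δ * ((i : ℝ) + 1))) ^ (k + 1) =
          Real.exp (-x) * Real.exp (-x) ^ i := by
        intro i
        rw [← Real.exp_nat_mul, ← Real.exp_nat_mul, ← Real.exp_add]
        congr 1
        push_cast
        ring
      simp only [this, ← mul_sum]
      rw [div_eq_mul_inv]
      refine mul_le_mul_of_nonneg_left ?_ (Real.exp_pos _).le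
      rw [← tsum_geometric_of_lt_one (Real.exp_pos _).le hy]
      exact (summable_geometric_of_lt_one (Real.exp_pos _).le hy).sum_le_tsum _
        fun i _ => by positivity
    have h2 := exp_neg_div_one_sub_le hx0
    rw [div_le_iff₀ hk0]
    split_ifs
    · have : (1 / ((k : ℝ) + 1) ^ 2 * (1 / δ) + (-(1 / 2 * ((k : ℝ) + 1)⁻¹) + δ / 4)) * (k + 1) =
          1 / x - 1 / 2 + x / 4 := by
        rw [hx]; field_simp; ring
      rw [this]; exact h1.trans h2.1
    · have : (1 / ((k : ℝ) + 1) ^ 2 * (1 / δ) + 0) * (k + 1) = 1 / x := by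
        rw [hx]; field_simp; ring
      rw [this]; exact h1.trans h2.2

lemma qPochhammer_pos {q : ℝ} (hq0 : 0 ≤ q) (hq1 : q < 1) (n : ℕ) : 0 < qPochhammer q n :=
  prod_pos fun _ _ => sub_pos.2 (pow_lt_one₀ hq0 hq1 (Nat.succ_ne_zero _))

/-- For the infinite product, the bound is sharp up to a constant factor as `q → 1`. The factor
`1 / √(1 - q)` matters: its cube compensates for part of the growth of the error term. -/
theorem le_qPochhammer {q : ℝ} (hq0 : 0 ≤ q) (hq1 : q < 1) (n : ℕ) :
    Real.exp (-(Real.pi ^ 2 / (6 * (1 - q))) - 1 / 4) / √(1 - q) ≤ qPochhammer q n := by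
  have hδ : 0 < 1 - q := sub_pos.2 hq1
  have h := sum_neg_log_one_sub_exp_le hδ n
  have hy : ∀ i : ℕ, 0 < 1 - Real.exp (-((1 - q) * ((i : ℝ) + 1))) := fun i => by
    have : 0 < (1 - q) * ((i : ℝ) + 1) := by positivity
    rw [sub_pos, Real.exp_lt_one_iff]; linarith
  have h1 : Real.exp (-(Real.pi ^ 2 / (6 * (1 - q))) - 1 / 4) / √(1 - q) ≤
      ∏ i ∈ range n, (1 - Real.exp (-((1 - q) * ((i : ℝ) + 1)))) := by
    have h2 : Real.log (∏ i ∈ range n, (1 - Real.exp (-((1 - q) * ((i : ℝ) + 1))))) =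
        ∑ i ∈ range n, Real.log (1 - Real.exp (-((1 - q) * ((i : ℝ) + 1)))) :=
      Real.log_prod fun i _ => (hy i).ne'
    rw [← Real.exp_log (prod_pos fun i _ => hy i), h2]
    have h3 : √(1 - q) = Real.exp (1 / 2 * Real.log (1 - q)) := by
      rw [Real.sqrt_eq_rpow, Real.rpow_def_of_pos hδ, mul_comm]
    rw [h3, ← Real.exp_sub, Real.exp_le_exp]
    rw [sum_neg_distrib] at h
    linarith
  refine h1.trans (prod_le_prod (fun i _ => (hy i).le) fun i _ => sub_le_sub_left ?_ _)
  have h4 : q ≤ Real.exp (-(1 - q)) := by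
    have := Real.add_one_le_exp (-(1 - q)); linarith
  calc q ^ (i + 1) ≤ Real.exp (-(1 - q)) ^ (i + 1) := pow_le_pow_left₀ hq0 h4 _
    _ = _ := by
      rw [← Real.exp_nat_mul]; congr 1; push_cast; ring

/-! ### Jacobi's identity for the cube of the Euler product -/

section
variable {R : Type*} [CommRing R]

lemma gaussBinom_comm (x : R) (a b : ℕ) : gaussBinom x a b = gaussBinom x b a := by
  induction a generalizing b with
  | zero => simp
  | succ a iha =>
    induction b with
    | zero => simp
    | succ b ihb => rw [gaussBinom_succ_succ, iha, ihb, gaussBinom_succ_succ']; ring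

lemma gaussBinom_mul_qPochhammer (x : R) (a b : ℕ) :
    gaussBinom x a b * (qPochhammer x a * qPochhammer x b) = qPochhammer x (a + b) := by
  induction a generalizing b with
  | zero => simp [qPochhammer]
  | succ a iha =>
    induction b with
    | zero => simp [qPochhammer]
    | succ b ihb =>
      have h1 := iha (b + 1)
      have e : ∀ n, qPochhammer x (n + 1) = qPochhammer x n * (1 - x ^ (n + 1)) :=
        fun n => prod_range_succ _ _
      rw [gaussBinom_succ_succ, show a + 1 + (b + 1) = (a + b + 1) + 1 by ring]
      rw [show a + 1 + b = a + b + 1 by ring] at ihb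
      rw [← add_assoc] at h1
      simp only [e] at h1 ihb ⊢
      have : x ^ (a + b + 1 + 1) = x ^ (a + 1) * x ^ (b + 1) := by rw [← pow_add]; congr 1; ring
      rw [this]
      linear_combination (1 - x ^ (a + 1)) * h1 + x ^ (a + 1) * (1 - x ^ (b + 1)) * ihb

/-- The coefficient `[2n+1 choose n-j]_x` of the finite version of Jacobi's identity. -/
def jacobiBinom (x : R) (n j : ℕ) : R := if j ≤ n then gaussBinom x (n - j) (n + 1 + j) else 0

lemma jacobiBinom_of_lt (x : R) {n j : ℕ} (h : n < j) : jacobiBinom x n j = 0 :=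
  if_neg (not_le.2 h)

lemma jacobiBinom_add (x : R) (a j : ℕ) :
    jacobiBinom x (a + j) j = gaussBinom x a (a + 2 * j + 1) := by
  rw [jacobiBinom, if_pos (by omega)]; congr 1 <;> omega

/-- The recurrence from `[2n+1 choose n-j]` to `[2n+3 choose n+1-j]`: Pascal's rule twice. -/
lemma gaussBinom_three_term (x : R) (a b : ℕ) :
    gaussBinom x (a + 2) (b + 2) = (1 + x ^ (a + b + 3)) * gaussBinom x (a + 1) (b + 1) +
      x ^ (a + 2) * gaussBinom x (a + 2) b + x ^ (b + 2) * gaussBinom x a (b + 2) := by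
  have h1 := gaussBinom_succ_succ' x (a + 1) (b + 1)
  have h2 := gaussBinom_succ_succ x a (b + 1)
  have h3 := gaussBinom_succ_succ x (a + 1) b
  linear_combination h1 + x ^ (b + 2) * h2 + h3

lemma gaussBinom_one_add_two (x : R) (b : ℕ) :
    gaussBinom x 1 (b + 2) = (1 + x ^ (b + 2)) + x * gaussBinom x 1 b := by
  have h1 := gaussBinom_succ_succ' x 0 (b + 1)
  have h2 := gaussBinom_succ_succ x 0 b
  simp only [gaussBinom_zero_left, zero_add] at h1 h2
  linear_combination h1 + h2

lemma jacobiBinom_succ_zero (x : R) (n : ℕ) :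
    jacobiBinom x (n + 1) 0 = (1 + x ^ (2 * n + 2)) * jacobiBinom x n 0 +
      x ^ (n + 1) * jacobiBinom x n 0 + x ^ (n + 2) * jacobiBinom x n 1 := by
  have h0 : ∀ a, jacobiBinom x a 0 = gaussBinom x a (a + 1) := fun a => by
    simpa using jacobiBinom_add x a 0
  rw [h0, h0]
  rcases n with _ | a
  · rw [jacobiBinom_of_lt x (by omega), gaussBinom_one_add_two x 0]
    simp
  · rw [jacobiBinom_add x a 1]
    have := gaussBinom_three_term x a (a + 1)
    rw [gaussBinom_comm x (a + 2) (a + 1)] at this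
    rw [show 2 * (a + 1) + 2 = a + (a + 1) + 3 by ring]
    exact this

lemma jacobiBinom_succ_succ (x : R) (n j : ℕ) :
    jacobiBinom x (n + 1) (j + 1) = (1 + x ^ (2 * n + 2)) * jacobiBinom x n (j + 1) +
      x ^ (n - j) * jacobiBinom x n j + x ^ (n + j + 3) * jacobiBinom x n (j + 2) := by
  rcases lt_or_ge n j with h | h
  · simp only [jacobiBinom_of_lt x (show n < j + 1 by omega), jacobiBinom_of_lt x h,
      jacobiBinom_of_lt x (show n < j + 2 by omega),
      jacobiBinom_of_lt x (show n + 1 < j + 1 by omega)]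
    ring
  · obtain ⟨a, rfl⟩ : ∃ a, n = a + j := ⟨n - j, by omega⟩
    rw [show a + j + 1 = a + (j + 1) by ring, jacobiBinom_add, jacobiBinom_add,
      Nat.add_sub_cancel]
    rcases a with _ | _ | a
    · rw [jacobiBinom_of_lt x (by omega), jacobiBinom_of_lt x (by omega)]
      simp
    · rw [show 0 + 1 + j = 0 + (j + 1) by ring, jacobiBinom_add, jacobiBinom_of_lt x (by omega),
        show 0 + 1 + 2 * (j + 1) + 1 = (2 * j + 2) + 2 by ring, gaussBinom_one_add_two]
      simp only [zero_add, gaussBinom_zero_left]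
      rw [show 1 + 2 * j + 1 = 2 * j + 2 by ring]
      ring
    · have h1 := jacobiBinom_add x (a + 1) (j + 1)
      have h2 := jacobiBinom_add x a (j + 2)
      rw [show a + 1 + (j + 1) = a + 1 + 1 + j by ring] at h1
      rw [show a + (j + 2) = a + 1 + 1 + j by ring] at h2
      have := gaussBinom_three_term x a (a + 2 * j + 3)
      rw [h1, h2]
      ring_nf at this ⊢
      exact this

end

section
variable {R : Type*} [CommRing R]

/-- The factor `(1 - c)²` appears because the weights `2j + 1` are linear in `j` and odd under the
reflection `j ↦ -1 - j`, which accounts for the exceptional recurrence at `0`. -/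
lemma sum_odd_mul_three_term (c : R) (v w : ℕ → R)
    (h0 : w 0 = (1 + c ^ 2) * v 0 + c * v 0 - c * v 1)
    (hs : ∀ j, w (j + 1) = (1 + c ^ 2) * v (j + 1) - c * (v j + v (j + 2))) (M : ℕ) :
    ∑ j ∈ range (M + 1), (2 * (j : R) + 1) * w j =
      (1 - c) ^ 2 * ∑ j ∈ range (M + 1), (2 * (j : R) + 1) * v j +
        c * ((2 * M + 3) * v M - (2 * M + 1) * v (M + 1)) := by
  induction M with
  | zero => simp [h0]; ring
  | succ M ih =>
    rw [sum_range_succ, ih, sum_range_succ _ (M + 1), hs]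
    push_cast
    ring

/-- The finite version of Jacobi's identity. -/
lemma sum_odd_mul_jacobiBinom (x : R) (n : ℕ) :
    ∑ j ∈ range (n + 1), (2 * (j : R) + 1) *
      ((-1) ^ j * x ^ (j * (j + 1) / 2) * jacobiBinom x n j) = qPochhammer x n ^ 2 := by
  induction n with
  | zero => simp [jacobiBinom, qPochhammer]
  | succ n ih =>
    rw [sum_odd_mul_three_term (x ^ (n + 1))
      (fun j => (-1) ^ j * x ^ (j * (j + 1) / 2) * jacobiBinom x n j), sum_range_succ, ih,
      jacobiBinom_of_lt x (show n < n + 1 by omega),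
      jacobiBinom_of_lt x (show n < n + 1 + 1 by omega), qPochhammer, qPochhammer, prod_range_succ]
    · ring
    · rw [jacobiBinom_succ_zero]
      simp
      ring
    · intro j
      rw [jacobiBinom_succ_succ]
      have e1 : x ^ (2 * n + 2) = (x ^ (n + 1)) ^ 2 := by rw [← pow_mul]; congr 1; ring
      rcases lt_or_ge n j with h | h
      · simp only [jacobiBinom_of_lt x (show n < j + 1 by omega), jacobiBinom_of_lt x h,
          jacobiBinom_of_lt x (show n < j + 2 by omega)]
        ring
      · have e2 : x ^ (n + 1) = x ^ (n - j) * x ^ (j + 1) := by rw [← pow_add]; congr 1; omega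
        have e3 : x ^ (n + j + 3) = x ^ (n + 1) * x ^ (j + 2) := by
          rw [← pow_add]; congr 1; ring
        rw [triangle_succ (j + 1), triangle_succ j, e1, e3, pow_add, pow_add x _ (j + 1 + 1),
          pow_succ (-1 : R) (j + 1), pow_succ (-1 : R) j, pow_add x _ (j + 1)]
        have e4 : x ^ (j + 1) * x ^ (n - j) = x ^ (n + 1) := by rw [e2]; ring
        linear_combination (-((-1) ^ j * x ^ (j * (j + 1) / 2) * jacobiBinom x n j)) * e4

end

/-- The infinite Euler product `P`, as the limit of the finite ones. -/
lemma tendsto_qPochhammer {q : ℝ} (hq0 : 0 ≤ q) (hq1 : q < 1) :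
    ∃ P : ℝ, 0 < P ∧ Real.exp (-(Real.pi ^ 2 / (6 * (1 - q))) - 1 / 4) / √(1 - q) ≤ P ∧
      (∀ n, P ≤ qPochhammer q n) ∧ Tendsto (qPochhammer q) atTop (𝓝 P) ∧
      eulerProductCubed q = P ^ 3 := by
  have hanti : Antitone (qPochhammer q) := antitone_nat_of_succ_le fun n => by
    rw [qPochhammer, prod_range_succ]
    exact mul_le_of_le_one_right (qPochhammer_pos hq0 hq1 n).le
      (sub_le_self _ (pow_nonneg hq0 _))
  have hbdd : BddBelow (Set.range (qPochhammer q)) :=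
    ⟨_, Set.forall_mem_range.2 (le_qPochhammer hq0 hq1)⟩
  have hlim := tendsto_atTop_ciInf hanti hbdd
  refine ⟨_, ?_, le_ciInf (le_qPochhammer hq0 hq1), ciInf_le hbdd, hlim, ?_⟩
  · refine lt_of_lt_of_le ?_ (le_ciInf (le_qPochhammer hq0 hq1))
    have : 0 < 1 - q := sub_pos.2 hq1
    positivity
  · have hs : Summable fun j : ℕ => ‖-q ^ (j + 1)‖ := by
      simp only [norm_neg, norm_pow, Real.norm_of_nonneg hq0]
      exact (summable_nat_add_iff 1).2 (summable_geometric_of_lt_one hq0 hq1)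
    have hm := multipliable_one_add_of_summable hs
    simp only [← sub_eq_add_neg] at hm
    have h3 : HasProd (fun j : ℕ => (1 - q ^ (j + 1)) ^ 3) ((∏' j : ℕ, (1 - q ^ (j + 1))) ^ 3) :=
      hm.hasProd.pow 3
    rw [eulerProductCubed, h3.tprod_eq]
    congr 1
    exact tendsto_nhds_unique hm.hasProd.tendsto_prod_nat hlim

lemma le_triangle (j : ℕ) : j ≤ j * (j + 1) / 2 := by
  induction j with
  | zero => simp
  | succ j _ => rw [triangle_succ]; omega

lemma summable_poly_mul_pow_triangle {q : ℝ} (hq0 : 0 ≤ q) (hq1 : q < 1) :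
    Summable fun j : ℕ => (2 * (j : ℝ) + 1) * q ^ (j * (j + 1) / 2) := by
  have h1 : Summable fun j : ℕ => (j : ℝ) * q ^ j := by
    simpa using summable_pow_mul_geometric_of_norm_lt_one 1
      (show ‖q‖ < 1 by rwa [Real.norm_of_nonneg hq0])
  refine Summable.of_nonneg_of_le (fun j => by positivity) (fun j => ?_)
    ((h1.mul_left 2).add (summable_geometric_of_lt_one hq0 hq1))
  have : q ^ (j * (j + 1) / 2) ≤ q ^ j := pow_le_pow_of_le_one hq0 hq1.le (le_triangle j)
  calc (2 * (j : ℝ) + 1) * q ^ (j * (j + 1) / 2) ≤ (2 * (j : ℝ) + 1) * q ^ j := by gcongr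
    _ = _ := by ring

lemma summable_jacobi {q : ℝ} (hq0 : 0 ≤ q) (hq1 : q < 1) :
    Summable fun j : ℕ => (2 * (j : ℝ) + 1) * ((-1) ^ j * q ^ (j * (j + 1) / 2)) := by
  refine (summable_poly_mul_pow_triangle hq0 hq1).of_norm_bounded fun j => ?_
  rw [norm_mul, norm_mul, norm_pow, norm_neg, norm_one, one_pow, one_mul,
    Real.norm_of_nonneg (by positivity), Real.norm_of_nonneg (by positivity)]

lemma summable_altTriangular {q : ℝ} (hq0 : 0 ≤ q) (hq1 : q < 1) :
    Summable fun j : ℕ => (-1 : ℝ) ^ j * q ^ (j * (j + 1) / 2) := by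
  refine (summable_poly_mul_pow_triangle hq0 hq1).of_norm_bounded fun j => ?_
  rw [norm_mul, norm_pow, norm_neg, norm_one, one_pow,
    Real.norm_of_nonneg (by positivity)]
  gcongr
  have : (0 : ℝ) ≤ j := by positivity
  linarith

/-- **Jacobi's identity** `∑_j (-1)^j (2j+1) q^(j(j+1)/2) = ∏_j (1 - q^j)^3`, as the limit of the
finite version by dominated convergence: `[2n+1 choose n-j]_q` tends to `1 / P`, and is bounded by
it. -/
theorem tsum_odd_mul_pow_triangle {q : ℝ} (hq0 : 0 ≤ q) (hq1 : q < 1) :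
    ∑' j : ℕ, (2 * (j : ℝ) + 1) * ((-1) ^ j * q ^ (j * (j + 1) / 2)) = eulerProductCubed q := by
  obtain ⟨P, hP, -, hPle, hlim, heq⟩ := tendsto_qPochhammer hq0 hq1
  have hfin : ∀ n, ∑' j : ℕ, (2 * (j : ℝ) + 1) *
      ((-1) ^ j * q ^ (j * (j + 1) / 2) * jacobiBinom q n j) = qPochhammer q n ^ 2 := fun n => by
    rw [← sum_odd_mul_jacobiBinom, tsum_eq_sum]
    intro j hj
    rw [jacobiBinom_of_lt q (by simpa using hj)]
    simp
  have hval : ∀ n j, j ≤ n → jacobiBinom q n j =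
      qPochhammer q (2 * n + 1) / (qPochhammer q (n - j) * qPochhammer q (n + 1 + j)) := by
    intro n j hj
    rw [eq_div_iff (mul_pos (qPochhammer_pos hq0 hq1 _) (qPochhammer_pos hq0 hq1 _)).ne',
      jacobiBinom, if_pos hj, gaussBinom_mul_qPochhammer]
    congr 1; omega
  have h1 : Tendsto (fun n => ∑' j : ℕ, (2 * (j : ℝ) + 1) *
      ((-1) ^ j * q ^ (j * (j + 1) / 2) * jacobiBinom q n j)) atTop
      (𝓝 (∑' j : ℕ, (2 * (j : ℝ) + 1) * ((-1) ^ j * q ^ (j * (j + 1) / 2) * (P / (P * P))))) := by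
    refine tendsto_tsum_of_dominated_convergence
      ((summable_poly_mul_pow_triangle hq0 hq1).mul_right P⁻¹) (fun j => ?_)
      (Eventually.of_forall fun n j => ?_)
    · have : Tendsto (fun n => qPochhammer q (2 * n + 1) /
          (qPochhammer q (n - j) * qPochhammer q (n + 1 + j))) atTop (𝓝 (P / (P * P))) := by
        refine Tendsto.div (hlim.comp ?_) (Tendsto.mul (hlim.comp ?_) (hlim.comp ?_))
          (mul_pos hP hP).ne'
        · exact tendsto_atTop_mono (fun n => by simp only [id]; omega) tendsto_id
        · exact tendsto_sub_atTop_nat j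
        · exact tendsto_atTop_mono (fun n => by simp only [id]; omega) tendsto_id
      refine Tendsto.const_mul _ (Tendsto.const_mul _ (this.congr' ?_))
      filter_upwards [eventually_ge_atTop j] with n hn using (hval n j hn).symm
    · have hb : |jacobiBinom q n j| ≤ P⁻¹ := by
        rcases lt_or_ge n j with h | h
        · rw [jacobiBinom_of_lt q h, abs_zero]; positivity
        · have p1 := qPochhammer_pos hq0 hq1 (n - j)
          have p2 := qPochhammer_pos hq0 hq1 (n + 1 + j)
          have p3 := qPochhammer_pos hq0 hq1 (2 * n + 1)
          have hle : qPochhammer q (2 * n + 1) ≤ qPochhammer q (n - j) := by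
            rw [show 2 * n + 1 = (n - j) + (n + 1 + j) by omega, qPochhammer, prod_range_add]
            refine mul_le_of_le_one_right p1.le (prod_le_one (fun i _ => ?_) fun i _ => ?_)
            · exact sub_nonneg.2 (pow_le_one₀ hq0 hq1.le)
            · exact sub_le_self _ (pow_nonneg hq0 _)
          rw [hval n j h, abs_of_pos (by positivity), div_le_iff₀ (by positivity), inv_mul_eq_div,
            le_div_iff₀ hP]
          exact mul_le_mul hle (hPle _) hP.le p1.le
      rw [norm_mul, norm_mul, norm_mul, norm_pow, norm_neg, norm_one, one_pow, one_mul,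
        Real.norm_of_nonneg (show 0 ≤ 2 * (j : ℝ) + 1 by positivity),
        Real.norm_of_nonneg (show 0 ≤ q ^ (j * (j + 1) / 2) by positivity), mul_assoc]
      gcongr
      exact hb
  simp only [hfin] at h1
  have h2 := tendsto_nhds_unique h1 (hlim.pow 2)
  have h3 : ∀ j : ℕ, (2 * (j : ℝ) + 1) * ((-1) ^ j * q ^ (j * (j + 1) / 2) * (P / (P * P))) =
      (2 * (j : ℝ) + 1) * ((-1) ^ j * q ^ (j * (j + 1) / 2)) * P⁻¹ := fun j => by
    field_simp
  simp only [h3, tsum_mul_right] at h2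
  rw [heq, pow_succ, ← h2]
  field_simp

/-! ### A lower bound for the alternating triangular series -/

/-- With `b_j = q^(j(j+1)/2)`, the series is the sum `E` of the differences `b_(2i) - b_(2i+1)`. The
remaining differences `b_(2i+1) - b_(2i+2)` have sum `1 - E`, and each is at most twice the
preceding one, so `1 - E ≤ 2 E`. -/
theorem one_third_le_altTriangularSeries {q : ℝ} (hq0 : 0 ≤ q) (hq1 : q < 1) :
    1 / 3 ≤ altTriangularSeries q := by
  have hb : Summable fun j : ℕ => q ^ (j * (j + 1) / 2) := by
    refine (summable_poly_mul_pow_triangle hq0 hq1).of_nonneg_of_le (fun j => by positivity)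
      fun j => ?_
    have : (0 : ℝ) ≤ j := by positivity
    exact le_mul_of_one_le_left (by positivity) (by linarith)
  set b : ℕ → ℝ := fun j => q ^ (j * (j + 1) / 2) with hbdef
  have he : Summable fun i => b (2 * i) := hb.comp_injective (mul_right_injective₀ two_ne_zero)
  have ho : Summable fun i => b (2 * i + 1) :=
    hb.comp_injective fun i j h => by simpa using h
  have ho' : Summable fun i => b (2 * (i + 1)) := (summable_nat_add_iff 1).2 he
  have hf : altTriangularSeries q = ∑' i, (b (2 * i) - b (2 * i + 1)) := by
    rw [altTriangularSeries, he.tsum_sub ho, ← tsum_even_add_odd]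
    · simp only [pow_mul, pow_succ]
      simp [tsum_neg, sub_eq_add_neg, hbdef]
    · simpa [pow_mul] using he
    · simpa [pow_mul, pow_succ] using ho.neg
  have hone : ∑' i, (b (2 * i) - b (2 * i + 1)) + ∑' i, (b (2 * i + 1) - b (2 * (i + 1))) = 1 := by
    rw [he.tsum_sub ho, ho.tsum_sub ho', he.tsum_eq_zero_add]
    simp [hbdef]
  have hle : ∑' i, (b (2 * i + 1) - b (2 * (i + 1))) ≤ 2 * ∑' i, (b (2 * i) - b (2 * i + 1)) := by
    rw [← tsum_mul_left]
    refine (ho.sub ho').tsum_le_tsum (fun i => ?_) ((he.sub ho).mul_left 2)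
    have e1 : b (2 * i + 1) = b (2 * i) * q ^ (2 * i + 1) := by
      simp only [hbdef]; rw [triangle_succ, pow_add]
    have e2 : b (2 * (i + 1)) = b (2 * i) * q ^ (2 * i + 1) * (q ^ (2 * i + 1) * q) := by
      rw [← e1, show 2 * (i + 1) = 2 * i + 1 + 1 by ring]
      simp only [hbdef]; rw [triangle_succ, pow_add, pow_succ q (2 * i + 1)]
    have h0 : 0 ≤ b (2 * i) := pow_nonneg hq0 _
    set y := q ^ (2 * i + 1) with hy
    have hy0 : 0 ≤ y := pow_nonneg hq0 _
    have hy1 : y ≤ 1 := pow_le_one₀ hq0 hq1.le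
    have hyq : y ≤ q := pow_le_of_le_one hq0 hq1.le (by omega)
    rw [e1, e2]
    have h1 : y * (1 - y * q) ≤ 2 * (1 - y) :=
      calc y * (1 - y * q) ≤ 1 * (1 - y * y) := by
            gcongr
            nlinarith
        _ = (1 + y) * (1 - y) := by ring
        _ ≤ 2 * (1 - y) := by gcongr; linarith
    calc b (2 * i) * y - b (2 * i) * y * (y * q) = b (2 * i) * (y * (1 - y * q)) := by ring
      _ ≤ b (2 * i) * (2 * (1 - y)) := by gcongr
      _ = _ := by ring
  rw [hf]
  linarith

/-! ### The coefficients of the exact formula against their limits -/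

/-- The ballot formula `[y^k] C(y)^r = r / (2k+r) * binom (2k+r) k`. -/
lemma catalanPow_mul (r k : ℕ) :
    catalanPow r k * (2 * k + r) = r * Nat.choose (2 * k + r) k := by
  induction k generalizing r with
  | zero => simp [catalanPow_zero_right]
  | succ k ihk =>
    induction r with
    | zero => simp [catalanPow_zero_succ]
    | succ r ihr =>
      have h1 := ihk (r + 2)
      have hM : 0 < 2 * k + r + 2 := by omega
      refine Nat.eq_of_mul_eq_mul_right hM ?_
      rw [catalanPow_succ_succ, show 2 * (k + 1) + (r + 1) = (2 * k + r + 2) + 1 by ring,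
        Nat.choose_succ_succ]
      rw [show 2 * (k + 1) + r = 2 * k + r + 2 by ring] at ihr
      rw [show 2 * k + (r + 2) = 2 * k + r + 2 by ring] at h1
      have h2 := Nat.choose_succ_right_eq (2 * k + r + 2) k
      rw [show 2 * k + r + 2 - k = k + r + 2 by omega] at h2
      zify at *
      linear_combination (2 * (k : ℤ) + r + 3) * (h1 + ihr) - 2 * h2

lemma catalanPow_add_two (r k : ℕ) :
    r * (k + r + 2) * catalanPow (r + 2) k = (r + 2) * (k + 1) * catalanPow r (k + 1) := by
  have h1 := catalanPow_mul (r + 2) k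
  have h2 := catalanPow_mul r (k + 1)
  have h3 := Nat.choose_succ_right_eq (2 * k + r + 2) k
  rw [show 2 * k + r + 2 - k = k + r + 2 by omega] at h3
  rw [show 2 * (k + 1) + r = 2 * k + r + 2 by ring] at h2
  rw [show 2 * k + (r + 2) = 2 * k + r + 2 by ring] at h1
  refine Nat.eq_of_mul_eq_mul_right (show 0 < 2 * k + r + 2 by omega) ?_
  zify at *
  linear_combination (r : ℤ) * (k + r + 2) * h1 - (r + 2) * (k + 1) * h2 - r * (r + 2) * h3

lemma catalanPow_add_one (r k : ℕ) :
    r * (k + r + 1) * catalanPow (r + 1) k = (r + 1) * (2 * k + r) * catalanPow r k := by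
  rcases k with _ | k
  · simp [catalanPow_zero_right]; ring
  · have h1 := catalanPow_add_two r k
    rw [catalanPow_succ_succ]
    zify at *
    linear_combination h1

/-- The quotient of `[y^n] y^J C(y)^(2J+ℓ)` by `2J + ℓ`; it is close to `2^(ℓ-1) * catalan n`. -/
noncomputable def ballotRatio (ℓ n J : ℕ) : ℝ := shiftedCatalanPow ℓ n J / (2 * J + ℓ)

lemma ballotRatio_nonneg (ℓ n J : ℕ) : 0 ≤ ballotRatio ℓ n J := by
  unfold ballotRatio; positivity

lemma ballotRatio_succ {ℓ : ℕ} (hℓ : 1 ≤ ℓ) {n J : ℕ} (hJ : J ≤ n) :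
    ((n : ℝ) + ℓ + J + 1) * ballotRatio ℓ n (J + 1) = ((n : ℝ) - J) * ballotRatio ℓ n J := by
  obtain ⟨k, rfl⟩ : ∃ k, n = J + k := ⟨n - J, by omega⟩
  have hℓ' : (1 : ℝ) ≤ ℓ := by exact_mod_cast hℓ
  rcases k with _ | k
  · simp [ballotRatio, shiftedCatalanPow]
  · have h := catalanPow_add_two (2 * J + ℓ) k
    simp only [ballotRatio, shiftedCatalanPow, if_pos (show J + 1 ≤ J + (k + 1) by omega),
      if_pos hJ,
      show J + (k + 1) - (J + 1) = k by omega, show J + (k + 1) - J = k + 1 by omega,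
      show 2 * (J + 1) + ℓ = 2 * J + ℓ + 2 by ring]
    have h' : ((2 * J + ℓ) * (k + (2 * J + ℓ) + 2) * catalanPow (2 * J + ℓ + 2) k : ℝ) =
        (2 * J + ℓ + 2) * (k + 1) * catalanPow (2 * J + ℓ) (k + 1) := by exact_mod_cast h
    push_cast
    field_simp
    linear_combination h'

lemma ballotRatio_eq_zero {ℓ n J : ℕ} (h : n < J) : ballotRatio ℓ n J = 0 := by
  simp [ballotRatio, shiftedCatalanPow, not_le.2 h]

lemma ballotRatio_succ_le {ℓ : ℕ} (hℓ : 1 ≤ ℓ) (n J : ℕ) :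
    ballotRatio ℓ n (J + 1) ≤ ballotRatio ℓ n J ∧
      n * (ballotRatio ℓ n J - ballotRatio ℓ n (J + 1)) ≤ (ℓ + 2 * J + 1) * ballotRatio ℓ n J := by
  have h0 := ballotRatio_nonneg ℓ n J
  rcases le_or_gt J n with h | h
  · have h1 := ballotRatio_succ hℓ h
    have h2 := ballotRatio_nonneg ℓ n (J + 1)
    have hle : ballotRatio ℓ n (J + 1) ≤ ballotRatio ℓ n J := by
      by_contra! hlt
      have : ((n : ℝ) - J) * ballotRatio ℓ n J ≤ (n + ℓ + J + 1) * ballotRatio ℓ n J := by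
        gcongr; linarith [(Nat.cast_nonneg J : (0 : ℝ) ≤ J), (Nat.cast_nonneg ℓ : (0 : ℝ) ≤ ℓ)]
      have h3 : ((n : ℝ) + ℓ + J + 1) * ballotRatio ℓ n J <
        (n + ℓ + J + 1) * ballotRatio ℓ n (J + 1) := by gcongr
      linarith
    refine ⟨hle, ?_⟩
    have : ((ℓ : ℝ) + J + 1) * ballotRatio ℓ n (J + 1) ≤ (ℓ + J + 1) * ballotRatio ℓ n J := by
      gcongr
    linarith
  · rw [ballotRatio_eq_zero h, ballotRatio_eq_zero (by omega)]; simp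

lemma ballotRatio_bounds {ℓ : ℕ} (hℓ : 1 ≤ ℓ) (n J : ℕ) :
    ballotRatio ℓ n J ≤ ballotRatio ℓ n 0 ∧
      n * (ballotRatio ℓ n 0 - ballotRatio ℓ n J) ≤ J * (J + ℓ) * ballotRatio ℓ n 0 := by
  induction J with
  | zero => simp
  | succ J ih =>
    obtain ⟨h1, h2⟩ := ballotRatio_succ_le hℓ n J
    refine ⟨h1.trans ih.1, ?_⟩
    have : ((ℓ : ℝ) + 2 * J + 1) * ballotRatio ℓ n J ≤ (ℓ + 2 * J + 1) * ballotRatio ℓ n 0 := by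
      gcongr; exact ih.1
    push_cast
    linarith [ih.2]

lemma ballotRatio_zero_bounds {ℓ : ℕ} (hℓ : 1 ≤ ℓ) (n : ℕ) :
    ballotRatio ℓ n 0 ≤ 2 ^ (ℓ - 1) * catalan n ∧
      n * (2 ^ (ℓ - 1) * catalan n - ballotRatio ℓ n 0) ≤ 2 ^ ℓ * ℓ ^ 2 * catalan n := by
  induction ℓ, hℓ using Nat.le_induction with
  | base => simp [ballotRatio, shiftedCatalanPow, catalanPow_one]
  | succ ℓ hℓ ih =>
    obtain ⟨ℓ, rfl⟩ : ∃ k, ℓ = k + 1 := ⟨ℓ - 1, by omega⟩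
    have h0 := ballotRatio_nonneg (ℓ + 1) n 0
    have h1 := ballotRatio_nonneg (ℓ + 1 + 1) n 0
    have hrec : ((n : ℝ) + ℓ + 2) * ballotRatio (ℓ + 1 + 1) n 0 =
        (2 * n + ℓ + 1) * ballotRatio (ℓ + 1) n 0 := by
      have h := catalanPow_add_one (ℓ + 1) n
      have h' : (((ℓ : ℝ) + 1) * (n + (ℓ + 1) + 1) * catalanPow (ℓ + 1 + 1) n : ℝ) =
        (ℓ + 1 + 1) * (2 * n + (ℓ + 1)) * catalanPow (ℓ + 1) n := by exact_mod_cast h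
      simp only [ballotRatio, shiftedCatalanPow, Nat.zero_le, if_true, mul_zero, zero_add,
        Nat.sub_zero]
      push_cast
      rw [show (2 : ℝ) * 0 + (ℓ + 1 + 1) = ℓ + 2 by ring,
        show (2 : ℝ) * 0 + (ℓ + 1) = ℓ + 1 by ring]
      field_simp
      linear_combination h'
    set S := ballotRatio (ℓ + 1) n 0
    set S' := ballotRatio (ℓ + 1 + 1) n 0
    have hS' : S' ≤ 2 * S := by
      have : ((n : ℝ) + ℓ + 2) * S' ≤ (n + ℓ + 2) * (2 * S) := by
        rw [hrec]
        nlinarith [mul_nonneg (Nat.cast_nonneg ℓ : (0 : ℝ) ≤ ℓ) h0]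
      exact le_of_mul_le_mul_left this (by positivity)
    have hd : n * (2 * S - S') ≤ (ℓ + 3) * S := by
      have : ((ℓ : ℝ) + 2) * S' ≤ (ℓ + 2) * (2 * S) := by gcongr
      linarith
    simp only [Nat.add_sub_cancel] at ih ⊢
    have hc : (0 : ℝ) ≤ 2 ^ ℓ * catalan n := by positivity
    refine ⟨by rw [pow_succ]; linarith [ih.1], ?_⟩
    have h3 : ((ℓ : ℝ) + 3) * S ≤ (ℓ + 3) * (2 ^ ℓ * catalan n) := by gcongr; exact ih.1
    have h4 : n * (2 ^ (ℓ + 1) * (catalan n : ℝ) - S') =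
        2 * (n * (2 ^ ℓ * catalan n - S)) + n * (2 * S - S') := by ring
    rw [h4]
    refine (add_le_add (mul_le_mul_of_nonneg_left ih.2 zero_le_two) (hd.trans h3)).trans ?_
    have h5 : (2 ^ (ℓ + 1 + 1) * ((ℓ + 1 + 1 : ℕ) : ℝ) ^ 2 * catalan n : ℝ) -
      (2 * (2 ^ (ℓ + 1) * ((ℓ + 1 : ℕ) : ℝ) ^ 2 * catalan n) + (ℓ + 3) * (2 ^ ℓ * catalan n)) =
      (7 * ℓ + 9) * (2 ^ ℓ * catalan n) := by push_cast; ring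
    have : (0 : ℝ) ≤ (7 * ℓ + 9) * (2 ^ ℓ * catalan n) := by positivity
    linarith

lemma shiftedCatalanPow_le {ℓ : ℕ} (hℓ : 1 ≤ ℓ) (n J : ℕ) :
    (shiftedCatalanPow ℓ n J : ℝ) ≤ (2 * J + ℓ) * (2 ^ (ℓ - 1) * catalan n) := by
  have hpos : (0 : ℝ) < 2 * J + ℓ := by positivity
  have h := (ballotRatio_bounds hℓ n J).1.trans (ballotRatio_zero_bounds hℓ n).1
  rwa [ballotRatio, div_le_iff₀ hpos, mul_comm] at h

lemma abs_shiftedCatalanPow_sub_le {ℓ : ℕ} (hℓ : 1 ≤ ℓ) {n : ℕ} (hn : 1 ≤ n) (J : ℕ) :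
    |(shiftedCatalanPow ℓ n J : ℝ) - (2 * J + ℓ) * (2 ^ (ℓ - 1) * catalan n)| ≤
      (2 * J + ℓ) * (2 ^ ℓ * (J + ℓ) ^ 2 * catalan n / n) := by
  have hpos : (0 : ℝ) < 2 * J + ℓ := by positivity
  have hn' : (0 : ℝ) < n := by positivity
  rw [abs_sub_comm, abs_of_nonneg (sub_nonneg.2 (shiftedCatalanPow_le hℓ n J))]
  have h1 := ballotRatio_bounds hℓ n J
  have h2 := ballotRatio_zero_bounds hℓ n
  have h3 : (shiftedCatalanPow ℓ n J : ℝ) = (2 * J + ℓ) * ballotRatio ℓ n J := by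
    rw [ballotRatio]; field_simp
  rw [h3, ← mul_sub]
  refine mul_le_mul_of_nonneg_left ?_ hpos.le
  rw [le_div_iff₀ hn', mul_comm]
  have h4 : (J : ℝ) * (J + ℓ) * ballotRatio ℓ n 0 ≤ J * (J + ℓ) * (2 ^ (ℓ - 1) * catalan n) := by
    gcongr; exact h2.1
  have h5 : (2 : ℝ) ^ (ℓ - 1) ≤ 2 ^ ℓ := pow_le_pow_right₀ one_le_two (Nat.sub_le _ _)
  have h6 : (J : ℝ) * (J + ℓ) * (2 ^ (ℓ - 1) * catalan n) ≤ J * (J + ℓ) * (2 ^ ℓ * catalan n) := by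
    gcongr
  have h7 : (0 : ℝ) ≤ 2 ^ ℓ * catalan n * (J * ℓ) := by positivity
  linarith [h1.2, h2.2]

section choose
variable {n m : ℕ}

lemma shiftedChoose_succ (hn : 1 ≤ n) {K : ℕ} (hK : K ≤ m) :
    ((n : ℝ) - 1 + m - K) * shiftedChoose n m (K + 1) = (m - K) * shiftedChoose n m K := by
  obtain ⟨k, rfl⟩ : ∃ k, m = K + k := ⟨m - K, by omega⟩
  obtain ⟨n, rfl⟩ : ∃ k, n = k + 1 := ⟨n - 1, by omega⟩
  rcases k with _ | k
  · simp [shiftedChoose]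
  · simp only [shiftedChoose, if_pos hK, if_pos (show K + 1 ≤ K + (k + 1) by omega),
      show K + (k + 1) - (K + 1) = k by omega, show K + (k + 1) - K = k + 1 by omega,
      Nat.add_sub_cancel]
    have h := Nat.choose_mul_succ_eq (n + k) n
    rw [show n + k + 1 - n = k + 1 by omega] at h
    have h' : ((n + k).choose n : ℝ) * (n + k + 1) = ((n + k + 1).choose n : ℝ) * (k + 1) := by
      exact_mod_cast h
    rw [← add_assoc n k 1]
    push_cast
    linear_combination h'

lemma shiftedChoose_eq_zero {K : ℕ} (h : m < K) : shiftedChoose n m K = 0 :=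
  if_neg (not_le.2 h)

/-- The ratio `(m - K) / (n + m - 1 - K)` of consecutive coefficients may slightly exceed
`q = m / (m + n)`, but not the mean of `q` and `1`. -/
lemma shiftedChoose_succ_le (hn : 2 ≤ n) (K : ℕ) :
    (shiftedChoose n m (K + 1) : ℝ) ≤ (1 + (m : ℝ) / (m + n)) / 2 * shiftedChoose n m K := by
  rcases le_or_gt K m with h | h
  · have hn' : (2 : ℝ) ≤ n := by exact_mod_cast hn
    have hK : (K : ℝ) ≤ m := by exact_mod_cast h
    have hpos : (0 : ℝ) < (n : ℝ) - 1 + m - K := by linarith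
    have hmn : (0 : ℝ) < m + n := by positivity
    refine le_of_mul_le_mul_left ?_ hpos
    rw [shiftedChoose_succ (by omega) h, ← mul_assoc]
    refine mul_le_mul_of_nonneg_right ?_ (Nat.cast_nonneg _)
    have : ((n : ℝ) - 1 + m - K) * ((1 + (m : ℝ) / (m + n)) / 2) - (m - K) =
        ((n : ℝ) * (n - 1) + m * (n - 2) + K * n) / (2 * (m + n)) := by field_simp; ring
    have h2 : 0 ≤ ((n : ℝ) * (n - 1) + m * (n - 2) + K * n) / (2 * (m + n)) := by
      have h3 : 0 ≤ (n : ℝ) * (n - 1) := mul_nonneg (by linarith) (by linarith)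
      have h4 : 0 ≤ (m : ℝ) * (n - 2) := mul_nonneg (by positivity) (by linarith)
      positivity
    linarith
  · rw [shiftedChoose_eq_zero h, shiftedChoose_eq_zero (by omega)]; simp

lemma abs_shiftedChoose_succ_sub_le (hn : 2 ≤ n) (K : ℕ) :
    |(shiftedChoose n m (K + 1) : ℝ) - (m : ℝ) / (m + n) * shiftedChoose n m K| ≤
      (K + 1) / (n - 1) * shiftedChoose n m K := by
  rcases le_or_gt K m with h | h
  · have hn' : (2 : ℝ) ≤ n := by exact_mod_cast hn
    have hK : (K : ℝ) ≤ m := by exact_mod_cast h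
    have hpos : (0 : ℝ) < (n : ℝ) - 1 + m - K := by linarith
    have hmn : (0 : ℝ) < m + n := by positivity
    have h1 : (shiftedChoose n m (K + 1) : ℝ) =
        (m - K) / ((n : ℝ) - 1 + m - K) * shiftedChoose n m K := by
      have := shiftedChoose_succ (n := n) (by omega) h
      field_simp
      linear_combination this
    rw [h1, ← sub_mul, abs_mul, abs_of_nonneg (Nat.cast_nonneg (shiftedChoose n m K) : (0 : ℝ) ≤ _)]
    refine mul_le_mul_of_nonneg_right ?_ (Nat.cast_nonneg _)
    have h2 : ((m : ℝ) - K) / ((n : ℝ) - 1 + m - K) - m / (m + n) =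
        (m - K * n) / (((n : ℝ) - 1 + m - K) * (m + n)) := by field_simp; ring
    rw [h2, abs_div, abs_of_pos (mul_pos hpos hmn),
      div_le_div_iff₀ (mul_pos hpos hmn) (by linarith)]
    have h3 : |(m : ℝ) - K * n| ≤ (K + 1) * (m + n) := by
      have : (0 : ℝ) ≤ K * m := by positivity
      have : (0 : ℝ) ≤ K * n := by positivity
      rw [abs_le]; constructor <;> nlinarith
    calc |(m : ℝ) - K * n| * (n - 1) ≤ ((K + 1) * (m + n)) * ((n : ℝ) - 1 + m - K) := by
          refine mul_le_mul h3 ?_ ?_ ?_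
          · linarith
          · linarith
          · positivity
      _ = _ := by ring
  · rw [shiftedChoose_eq_zero h, shiftedChoose_eq_zero (by omega)]; simp

lemma shiftedChoose_le (hn : 2 ≤ n) (K : ℕ) :
    (shiftedChoose n m K : ℝ) ≤ ((1 + (m : ℝ) / (m + n)) / 2) ^ K * shiftedChoose n m 0 := by
  induction K with
  | zero => simp
  | succ K ih =>
    refine (shiftedChoose_succ_le hn K).trans ?_
    rw [pow_succ', mul_assoc]
    gcongr

/-- The product of the `K` ratios against `q^K`: replacing them by `q` one at a time, the `i`-th
replacement costs `O(i / n)`. -/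
lemma abs_shiftedChoose_sub_le (hn : 2 ≤ n) (K : ℕ) :
    |(shiftedChoose n m K : ℝ) - ((m : ℝ) / (m + n)) ^ K * shiftedChoose n m 0| ≤
      4 * K ^ 2 / n * ((1 + (m : ℝ) / (m + n)) / 2) ^ K * shiftedChoose n m 0 := by
  have hn' : (2 : ℝ) ≤ n := by exact_mod_cast hn
  set q := (m : ℝ) / (m + n) with hq
  set p := (1 + q) / 2 with hp
  have hq0 : 0 ≤ q := by positivity
  have hq1 : q ≤ 1 := div_le_one_of_le₀ (by linarith) (by positivity)
  set g : ℕ → ℝ := fun K => (shiftedChoose n m K : ℝ) with hg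
  have hg0 : ∀ K, 0 ≤ g K := fun K => Nat.cast_nonneg _
  have hp0 : 0 ≤ p := by positivity
  have hn1 : (0 : ℝ) < n - 1 := by linarith
  have key : p * |g K - q ^ K * g 0| ≤ K ^ 2 / (n - 1) * p ^ K * g 0 := by
    induction K with
    | zero => simp
    | succ K ih =>
      have h1 : |g (K + 1) - q ^ (K + 1) * g 0| ≤
          (K + 1) / (n - 1) * g K + q * |g K - q ^ K * g 0| := by
        have : g (K + 1) - q ^ (K + 1) * g 0 =
          (g (K + 1) - q * g K) + q * (g K - q ^ K * g 0) := by ring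
        rw [this]
        refine (abs_add_le _ _).trans (add_le_add (abs_shiftedChoose_succ_sub_le hn K) ?_)
        rw [abs_mul, abs_of_nonneg hq0]
      calc p * |g (K + 1) - q ^ (K + 1) * g 0|
          ≤ p * ((K + 1) / (n - 1) * g K + q * |g K - q ^ K * g 0|) := by gcongr
        _ = p * ((K + 1) / (n - 1) * g K) + q * (p * |g K - q ^ K * g 0|) := by ring
        _ ≤ p * ((K + 1) / (n - 1) * (p ^ K * g 0)) + p * (K ^ 2 / (n - 1) * p ^ K * g 0) := by
          have h2 : g K ≤ p ^ K * g 0 := shiftedChoose_le hn K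
          have h3 : q ≤ p := by rw [hp]; linarith
          gcongr
        _ = (K + 1 + K ^ 2) * (1 / (n - 1) * p ^ (K + 1) * g 0) := by ring
        _ ≤ (K + 1) ^ 2 * (1 / (n - 1) * p ^ (K + 1) * g 0) := by
          have : (0 : ℝ) ≤ K := by positivity
          have h4 := hg0 0
          gcongr
          nlinarith
        _ = _ := by push_cast; ring
  have h5 : (1 : ℝ) / (n - 1) ≤ 2 / n := by
    rw [div_le_div_iff₀ hn1 (by linarith)]; linarith
  have h6 : 1 / 2 * |g K - q ^ K * g 0| ≤ p * |g K - q ^ K * g 0| := by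
    gcongr; rw [hp]; linarith
  have h7 : K ^ 2 / (n - 1) * p ^ K * g 0 ≤ 2 / n * (K ^ 2 * p ^ K * g 0) := by
    have h4 := hg0 0
    calc K ^ 2 / (n - 1) * p ^ K * g 0 = 1 / (n - 1) * (K ^ 2 * p ^ K * g 0) := by ring
      _ ≤ _ := by gcongr
  have h8 : 4 * K ^ 2 / n * p ^ K * g 0 = 2 * (2 / n * (K ^ 2 * p ^ K * g 0)) := by ring
  change |g K - q ^ K * g 0| ≤ 4 * K ^ 2 / n * p ^ K * g 0
  rw [h8]
  linarith

end choose

/-! ### The error term, uniformly in the number of crossings -/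

lemma le_triangle_sum {ℓ : ℕ} (p : Fin ℓ → ℕ) : ∑ i, p i ≤ triangleSum p :=
  sum_le_sum fun i _ => le_triangle (p i)

lemma two_mul_triangle (j : ℕ) : 2 * (j * (j + 1) / 2) = j * (j + 1) :=
  Nat.mul_div_cancel' (Nat.even_mul_succ_self j).two_dvd

/-- The weight `2J + ℓ = ∑ (2 p_i + 1)` is only of the order of the square root of
`K = triangleSum p`; a bound linear in `K` would spoil the exponent of `1 - q` in the error term. -/
lemma odd_sum_le_sqrt {ℓ : ℕ} (p : Fin ℓ → ℕ) :
    2 * ((∑ i, p i : ℕ) : ℝ) + ℓ ≤ 3 * ℓ * √(triangleSum p + 1) := by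
  have h1 : 2 * ((∑ i, p i : ℕ) : ℝ) + ℓ = ∑ i, (2 * (p i : ℝ) + 1) := by
    simp [sum_add_distrib, mul_sum]
  have h2 : ∀ i, 2 * (p i : ℝ) + 1 ≤ 3 * √(triangleSum p + 1) := fun i => by
    have h3 : p i * (p i + 1) / 2 ≤ triangleSum p :=
      single_le_sum (f := fun i => p i * (p i + 1) / 2) (fun _ _ => Nat.zero_le _) (mem_univ i)
    have h4 := two_mul_triangle (p i)
    have h5 : p i * (p i + 1) ≤ 2 * triangleSum p := by omega
    have h6 : (p i : ℝ) * (p i + 1) ≤ 2 * triangleSum p := by exact_mod_cast h5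
    have h7 : (3 : ℝ) * √(triangleSum p + 1) = √(9 * (triangleSum p + 1)) := by
      rw [Real.sqrt_mul (by norm_num), show (9 : ℝ) = 3 ^ 2 by norm_num,
        Real.sqrt_sq (by norm_num)]
    rw [h7]
    refine Real.le_sqrt_of_sq_le ?_
    nlinarith
  rw [h1]
  refine (sum_le_sum fun i _ => h2 i).trans (le_of_eq ?_)
  simp; ring

lemma pow_five_le_exp {v : ℝ} (hv : 0 ≤ v) : v ^ 5 ≤ 400 * Real.exp (v ^ 2 / 4) := by
  have h1 := Real.pow_div_factorial_le_exp (v ^ 2 / 4) (by positivity) 3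
  have h2 : (v ^ 2 / 4) ^ 3 / (Nat.factorial 3 : ℝ) = v ^ 6 / 384 := by
    simp [Nat.factorial]; ring
  rw [h2] at h1
  have h3 : v ^ 5 ≤ 1 + v ^ 6 := by
    rcases le_total v 1 with h | h
    · have : v ^ 5 ≤ 1 := pow_le_one₀ hv h
      have : 0 ≤ v ^ 6 := by positivity
      linarith
    · have : v ^ 5 ≤ v ^ 6 := pow_le_pow_right₀ h (by norm_num)
      linarith
  have h4 : 1 ≤ Real.exp (v ^ 2 / 4) := Real.one_le_exp (by positivity)
  linarith

/-- Polynomial growth of order `5/2` in `K` costs a factor `s^(-5)` and half of the exponential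
decay. -/
lemma mul_pow_le_exp {s : ℝ} (hs0 : 0 < s) (hs1 : s ≤ 1) (K : ℕ) :
    √((K : ℝ) + 1) * ((K : ℝ) + 1) ^ 2 * (1 - s ^ 2 / 2) ^ K ≤
      1200 / s ^ 5 * Real.exp (-(s ^ 2 / 4 * K)) := by
  have hK : (0 : ℝ) ≤ K + 1 := by positivity
  have h1 := pow_five_le_exp (v := s * √((K : ℝ) + 1)) (by positivity)
  have h2 : (s * √((K : ℝ) + 1)) ^ 5 = s ^ 5 * (√((K : ℝ) + 1) * ((K : ℝ) + 1) ^ 2) := by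
    have := Real.sq_sqrt hK
    calc (s * √((K : ℝ) + 1)) ^ 5 = s ^ 5 * (√((K : ℝ) + 1) * (√((K : ℝ) + 1) ^ 2) ^ 2) := by ring
      _ = _ := by rw [this]
  have h3 : (s * √((K : ℝ) + 1)) ^ 2 / 4 = s ^ 2 / 4 + s ^ 2 / 4 * K := by
    rw [mul_pow, Real.sq_sqrt hK]; ring
  rw [h2, h3, Real.exp_add] at h1
  have h4 : Real.exp (s ^ 2 / 4) ≤ 3 := by
    have : Real.exp (s ^ 2 / 4) ≤ Real.exp 1 := Real.exp_le_exp.2 (by nlinarith)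
    linarith [Real.exp_one_lt_d9]
  have h5 : √((K : ℝ) + 1) * ((K : ℝ) + 1) ^ 2 ≤ 1200 / s ^ 5 * Real.exp (s ^ 2 / 4 * K) := by
    rw [div_mul_eq_mul_div, le_div_iff₀ (by positivity)]
    calc √((K : ℝ) + 1) * ((K : ℝ) + 1) ^ 2 * s ^ 5
        ≤ 400 * (Real.exp (s ^ 2 / 4) * Real.exp (s ^ 2 / 4 * K)) := by linarith
      _ ≤ 400 * (3 * Real.exp (s ^ 2 / 4 * K)) := by gcongr
      _ = _ := by ring
  have h6 : (1 - s ^ 2 / 2) ^ K ≤ Real.exp (-(s ^ 2 / 2 * K)) := by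
    have h7 : 1 - s ^ 2 / 2 ≤ Real.exp (-(s ^ 2 / 2)) := by
      have := Real.add_one_le_exp (-(s ^ 2 / 2)); linarith
    calc (1 - s ^ 2 / 2) ^ K ≤ Real.exp (-(s ^ 2 / 2)) ^ K :=
          pow_le_pow_left₀ (by nlinarith) h7 _
      _ = _ := by rw [← Real.exp_nat_mul]; congr 1; ring
  calc _ ≤ (1200 / s ^ 5 * Real.exp (s ^ 2 / 4 * K)) * Real.exp (-(s ^ 2 / 2 * K)) := by
        refine mul_le_mul h5 h6 (pow_nonneg (by nlinarith) _) (by positivity)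
    _ = _ := by rw [mul_assoc, ← Real.exp_add]; congr 2; ring

lemma sum_exp_neg_triangle_le {s : ℝ} (hs0 : 0 < s) (hs1 : s ≤ 1) (N : ℕ) :
    ∑ j ∈ range N, Real.exp (-(s ^ 2 / 4 * (j * (j + 1) / 2 : ℕ))) ≤ 8 / s := by
  have hy : Real.exp (-(s / 2)) < 1 := by rw [Real.exp_lt_one_iff]; linarith
  have h1 : ∀ j : ℕ, Real.exp (-(s ^ 2 / 4 * (j * (j + 1) / 2 : ℕ))) ≤
      2 * Real.exp (-(s / 2)) ^ j := fun j => by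
    have h2 : (2 : ℝ) * (j * (j + 1) / 2 : ℕ) = j * (j + 1) := by
      exact_mod_cast two_mul_triangle j
    have h3 : Real.exp (1 / 2) ≤ 2 := by
      have h4 : Real.exp (1 / 2) ^ 2 = Real.exp 1 := by
        rw [← Real.exp_nat_mul]; norm_num
      nlinarith [Real.exp_one_lt_d9, Real.exp_pos (1 / 2)]
    calc Real.exp (-(s ^ 2 / 4 * (j * (j + 1) / 2 : ℕ))) ≤ Real.exp (1 / 2 + j * (-(s / 2))) := by
          rw [Real.exp_le_exp]
          have h5 : (0 : ℝ) ≤ s ^ 2 * j := by positivity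
          nlinarith [sq_nonneg (s * j - 2)]
      _ = Real.exp (1 / 2) * Real.exp (-(s / 2)) ^ j := by
          rw [Real.exp_add, Real.exp_nat_mul]
      _ ≤ _ := by gcongr
  have h6 : s / 4 ≤ 1 - Real.exp (-(s / 2)) := by
    have h7 : Real.exp (-(s / 2)) ≤ 1 / (1 + s / 2) := by
      rw [Real.exp_neg, ← one_div]
      exact one_div_le_one_div_of_le (by positivity) (by linarith [Real.add_one_le_exp (s / 2)])
    have h8 : 1 / (1 + s / 2) ≤ 1 - s / 4 := by
      rw [div_le_iff₀ (by positivity)]; nlinarith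
    linarith
  calc _ ≤ ∑ j ∈ range N, 2 * Real.exp (-(s / 2)) ^ j := sum_le_sum fun j _ => h1 j
    _ = 2 * ∑ j ∈ range N, Real.exp (-(s / 2)) ^ j := by rw [mul_sum]
    _ ≤ 2 * (1 - Real.exp (-(s / 2)))⁻¹ := by
        rw [← tsum_geometric_of_lt_one (Real.exp_pos _).le hy]
        gcongr
        exact (summable_geometric_of_lt_one (Real.exp_pos _).le hy).sum_le_tsum _
          fun i _ => by positivity
    _ ≤ 2 * (s / 4)⁻¹ := by gcongr
    _ = 8 / s := by field_simp; norm_num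

lemma sum_piFinset_exp_neg_triangle_le (ℓ : ℕ) {s : ℝ} (hs0 : 0 < s) (hs1 : s ≤ 1) (N : ℕ) :
    ∑ p ∈ Fintype.piFinset fun _ : Fin ℓ => range N, Real.exp (-(s ^ 2 / 4 * (triangleSum p : ℕ))) ≤
      (8 / s) ^ ℓ := by
  have h : ∀ p : Fin ℓ → ℕ, Real.exp (-(s ^ 2 / 4 * (triangleSum p : ℕ))) =
      ∏ i, Real.exp (-(s ^ 2 / 4 * (p i * (p i + 1) / 2 : ℕ))) := fun p => by
    rw [← Real.exp_sum, triangleSum, sum_neg_distrib, ← mul_sum]; push_cast; rfl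
  simp only [h]
  rw [← prod_univ_sum (fun _ : Fin ℓ => range N)
    (fun _ j => Real.exp (-(s ^ 2 / 4 * (j * (j + 1) / 2 : ℕ))))]
  rw [prod_const, card_univ, Fintype.card_fin]
  exact pow_le_pow_left₀ (sum_nonneg fun _ _ => (Real.exp_pos _).le)
    (sum_exp_neg_triangle_le hs0 hs1 N) _

/-- Since `2J + ℓ = ∑_i (2 p_i + 1)`, the main terms are `ℓ` products of one-variable sums. -/
lemma sum_piFinset_main_term (ℓ : ℕ) (q : ℝ) (N : ℕ) :
    ∑ p ∈ Fintype.piFinset fun _ : Fin ℓ => range N,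
      (-1 : ℝ) ^ (∑ i, p i) * (2 * ((∑ i, p i : ℕ) : ℝ) + ℓ) * q ^ triangleSum p =
    ℓ * ((∑ j ∈ range N, (-1 : ℝ) ^ j * q ^ (j * (j + 1) / 2)) ^ (ℓ - 1) *
      ∑ j ∈ range N, (2 * (j : ℝ) + 1) * ((-1 : ℝ) ^ j * q ^ (j * (j + 1) / 2))) := by
  set b : ℕ → ℝ := fun j => (-1 : ℝ) ^ j * q ^ (j * (j + 1) / 2) with hb
  have h1 : ∀ p : Fin ℓ → ℕ,
      (-1 : ℝ) ^ (∑ i, p i) * (2 * ((∑ i, p i : ℕ) : ℝ) + ℓ) * q ^ triangleSum p =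
        ∑ i, ∏ k, (if k = i then 2 * (p k : ℝ) + 1 else 1) * b (p k) := fun p => by
    have h2 : 2 * ((∑ i, p i : ℕ) : ℝ) + ℓ = ∑ i, (2 * (p i : ℝ) + 1) := by
      simp [sum_add_distrib, mul_sum]
    simp only [prod_mul_distrib, prod_ite_eq', mem_univ, if_true, hb, prod_pow_eq_pow_sum]
    rw [← sum_mul, ← h2, triangleSum]
    ring
  simp only [h1]
  rw [sum_comm]
  have h3 : ∀ i : Fin ℓ, ∑ p ∈ Fintype.piFinset fun _ : Fin ℓ => range N,
      ∏ k, (if k = i then 2 * (p k : ℝ) + 1 else 1) * b (p k) =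
      (∑ j ∈ range N, b j) ^ (ℓ - 1) * ∑ j ∈ range N, (2 * (j : ℝ) + 1) * b j := fun i => by
    rw [← prod_univ_sum (fun _ : Fin ℓ => range N)
      (fun k j => (if k = i then 2 * (j : ℝ) + 1 else 1) * b j), ← mul_prod_erase _ _ (mem_univ i),
      mul_comm]
    congr 1
    · rw [prod_congr rfl (g := fun _ => ∑ j ∈ range N, b j), prod_const, card_erase_of_mem
        (mem_univ i), card_univ, Fintype.card_fin]
      intro k hk
      simp [(mem_erase.1 hk).1]
    · simp
  simp only [h3]
  simp [hb]

lemma abs_mul_sub_mul_le (a b r t : ℝ) (ha : 0 ≤ a) (ht : 0 ≤ t) :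
    |a * r - b * t| ≤ a * |r - t| + |a - b| * t := by
  have : a * r - b * t = a * (r - t) + (a - b) * t := by ring
  rw [this]
  refine (abs_add_le _ _).trans (le_of_eq ?_)
  rw [abs_mul, abs_mul, abs_of_nonneg ha, abs_of_nonneg ht]

lemma odd_mul_sq_le {ℓ J K : ℕ} (hℓ : 1 ≤ ℓ) (hJK : J ≤ K)
    (hsqrt : 2 * (J : ℝ) + ℓ ≤ 3 * ℓ * √((K : ℝ) + 1)) :
    (2 * (J : ℝ) + ℓ) * (2 * (K : ℝ) ^ 2 + ((J : ℝ) + ℓ) ^ 2) ≤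
      12 * ℓ ^ 3 * (√((K : ℝ) + 1) * ((K : ℝ) + 1) ^ 2) := by
  have hℓ1 : (1 : ℝ) ≤ ℓ := by exact_mod_cast hℓ
  have hK0 : (0 : ℝ) ≤ K := Nat.cast_nonneg K
  have hJK' : (J : ℝ) ≤ K := by exact_mod_cast hJK
  have hJℓ : (J : ℝ) + ℓ ≤ ℓ * (K + 1) := by nlinarith [mul_nonneg (sub_nonneg.2 hℓ1) hK0]
  have hKℓ : (K : ℝ) ≤ ℓ * (K + 1) := by nlinarith
  have h1 : ((J : ℝ) + ℓ) ^ 2 ≤ (ℓ * (K + 1)) ^ 2 := by gcongr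
  have h2 : (K : ℝ) ^ 2 ≤ (ℓ * (K + 1)) ^ 2 := by gcongr
  have h3 : 2 * (K : ℝ) ^ 2 + ((J : ℝ) + ℓ) ^ 2 ≤ 4 * (ℓ * (K + 1)) ^ 2 := by
    have : 0 ≤ ((ℓ : ℝ) * (K + 1)) ^ 2 := by positivity
    linarith
  calc _ ≤ (3 * ℓ * √((K : ℝ) + 1)) * (4 * (ℓ * (K + 1)) ^ 2) := by gcongr
    _ = _ := by ring

/-- A summand of the exact formula, without its sign, against its limit. -/
lemma abs_summand_sub_le {ℓ : ℕ} (hℓ : 1 ≤ ℓ) {n : ℕ} (hn : 2 ≤ n) (m : ℕ) {s : ℝ} (hs0 : 0 < s)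
    (hs1 : s ≤ 1) (hs2 : s ^ 2 = 1 - (m : ℝ) / (m + n)) {J K : ℕ} (hJK : J ≤ K)
    (hsqrt : 2 * (J : ℝ) + ℓ ≤ 3 * ℓ * √((K : ℝ) + 1)) :
    |(shiftedCatalanPow ℓ n J : ℝ) * (shiftedChoose n m K : ℝ) -
        (2 * J + ℓ) * (2 ^ (ℓ - 1) * catalan n) *
          (((m : ℝ) / (m + n)) ^ K * shiftedChoose n m 0)| ≤
      14400 * ℓ ^ 3 * 2 ^ ℓ / (n * s ^ 5) * (shiftedChoose n m 0 * catalan n) *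
        Real.exp (-(s ^ 2 / 4 * K)) := by
  have hA1 := shiftedCatalanPow_le hℓ n J
  have hA2 := abs_shiftedCatalanPow_sub_le hℓ (show 1 ≤ n by omega) J
  have hR := abs_shiftedChoose_sub_le (m := m) hn K
  have hE := mul_pow_le_exp hs0 hs1 K
  have hn0 : (0 : ℝ) < n := by positivity
  have hq0 : 0 ≤ (m : ℝ) / (m + n) := by positivity
  rw [show (1 + (m : ℝ) / (m + n)) / 2 = 1 - s ^ 2 / 2 by rw [hs2]; ring] at hR
  have hqP : ((m : ℝ) / (m + n)) ^ K ≤ (1 - s ^ 2 / 2) ^ K :=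
    pow_le_pow_left₀ hq0 (by linarith [sq_nonneg s]) _
  have hP0 : 0 ≤ (1 - s ^ 2 / 2) ^ K := pow_nonneg (by nlinarith) _
  have hA0 : (0 : ℝ) ≤ shiftedCatalanPow ℓ n J := Nat.cast_nonneg _
  have hB0 : (0 : ℝ) ≤ shiftedChoose n m 0 := Nat.cast_nonneg _
  have hpoly := odd_mul_sq_le hℓ hJK hsqrt
  have h2ℓ : (2 : ℝ) ^ ℓ = 2 * 2 ^ (ℓ - 1) := by rw [← pow_succ', Nat.sub_add_cancel hℓ]
  set P := (1 - s ^ 2 / 2) ^ K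
  set B : ℝ := (shiftedChoose n m 0 : ℝ)
  set c : ℝ := (catalan n : ℝ) with hc
  have hc0 : 0 ≤ c := Nat.cast_nonneg _
  have hF : 0 ≤ (2 : ℝ) ^ ℓ * (B * c) / n := by positivity
  refine (abs_mul_sub_mul_le _ _ _ _ hA0 (by positivity)).trans ?_
  calc _ ≤ (2 * J + ℓ) * (2 ^ (ℓ - 1) * c) * (4 * K ^ 2 / n * P * B) +
          (2 * J + ℓ) * (2 ^ ℓ * (J + ℓ) ^ 2 * c / n) * (P * B) :=
        add_le_add (mul_le_mul hA1 hR (abs_nonneg _) (by positivity))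
          (mul_le_mul hA2 (mul_le_mul_of_nonneg_right hqP hB0) (by positivity) (by positivity))
    _ = (2 * J + ℓ) * (2 * (K : ℝ) ^ 2 + (J + ℓ) ^ 2) * P * (2 ^ ℓ * (B * c) / n) := by
        rw [h2ℓ]; ring
    _ ≤ 12 * ℓ ^ 3 * (√(K + 1) * (K + 1) ^ 2) * P * (2 ^ ℓ * (B * c) / n) :=
        mul_le_mul_of_nonneg_right (mul_le_mul_of_nonneg_right hpoly hP0) hF
    _ = 12 * ℓ ^ 3 * (√(K + 1) * (K + 1) ^ 2 * P) * (2 ^ ℓ * (B * c) / n) := by ring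
    _ ≤ 12 * ℓ ^ 3 * (1200 / s ^ 5 * Real.exp (-(s ^ 2 / 4 * K))) * (2 ^ ℓ * (B * c) / n) :=
        mul_le_mul_of_nonneg_right (mul_le_mul_of_nonneg_left hE (by positivity)) hF
    _ = _ := by field_simp; ring

/-- The distance from the main term, uniformly in `m`. With `q = m / (m + n)` and `s = √(1 - q)`,
each summand contributes `s^(-5) / n` times a Gaussian weight, and the sum of the weights over the
`ℓ` indices is `O(s^(-ℓ))`. The truncated main terms converge as the truncation order `N` grows. -/
theorem abs_chordSeriesPowCoeff_sub_le {ℓ : ℕ} (hℓ : 1 ≤ ℓ) {n : ℕ} (hn : 2 ≤ n) (m : ℕ) :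
    |chordSeriesPowCoeff ℓ m n -
      ℓ * (2 * altTriangularSeries ((m : ℝ) / (m + n))) ^ (ℓ - 1) * (n + m - 1).choose (n - 1) *
        catalan n * eulerProductCubed ((m : ℝ) / (m + n))| ≤
      14400 * ℓ ^ 3 * 16 ^ ℓ / (n * √(1 - (m : ℝ) / (m + n)) ^ (ℓ + 5)) *
        ((n + m - 1).choose (n - 1) * catalan n) := by
  have hn0 : (0 : ℝ) < n := by positivity
  set q := (m : ℝ) / (m + n) with hq
  have hq0 : 0 ≤ q := by positivity
  have hq1 : q < 1 := (div_lt_one (by positivity)).2 (by linarith)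
  set s := √(1 - q) with hs
  have hs0 : 0 < s := Real.sqrt_pos.2 (by linarith)
  have hs2 : s ^ 2 = 1 - q := Real.sq_sqrt (by linarith)
  have hs1 : s ≤ 1 := Real.sqrt_le_one.2 (by linarith)
  have hB : (n + m - 1).choose (n - 1) = shiftedChoose n m 0 := by
    rw [shiftedChoose, if_pos (Nat.zero_le _)]; congr 1; omega
  rw [hB]
  set B : ℝ := (shiftedChoose n m 0 : ℝ) with hBdef
  have hB0 : 0 ≤ B := Nat.cast_nonneg _
  have hC0 : (0 : ℝ) ≤ catalan n := Nat.cast_nonneg _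
  have hterm : ∀ p : Fin ℓ → ℕ,
      |(-1 : ℝ) ^ (∑ i, p i) * (shiftedCatalanPow ℓ n (∑ i, p i) : ℝ) *
        (shiftedChoose n m (triangleSum p) : ℝ) -
        2 ^ (ℓ - 1) * catalan n * B *
          ((-1 : ℝ) ^ (∑ i, p i) * (2 * ((∑ i, p i : ℕ) : ℝ) + ℓ) * q ^ triangleSum p)| ≤
      14400 * ℓ ^ 3 * 2 ^ ℓ / (n * s ^ 5) * (B * catalan n) *
        Real.exp (-(s ^ 2 / 4 * (triangleSum p : ℕ))) := by
    intro p
    have hsign : (-1 : ℝ) ^ (∑ i, p i) * (shiftedCatalanPow ℓ n (∑ i, p i) : ℝ) *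
        (shiftedChoose n m (triangleSum p) : ℝ) -
        2 ^ (ℓ - 1) * catalan n * B *
          ((-1 : ℝ) ^ (∑ i, p i) * (2 * ((∑ i, p i : ℕ) : ℝ) + ℓ) * q ^ triangleSum p) =
        (-1 : ℝ) ^ (∑ i, p i) * ((shiftedCatalanPow ℓ n (∑ i, p i) : ℝ) *
          (shiftedChoose n m (triangleSum p) : ℝ) -
          (2 * ((∑ i, p i : ℕ) : ℝ) + ℓ) * (2 ^ (ℓ - 1) * catalan n) *
            (q ^ triangleSum p * B)) := by
      ring
    rw [hsign, abs_mul, abs_pow, abs_neg, abs_one, one_pow, one_mul]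
    exact abs_summand_sub_le hℓ hn m hs0 hs1 hs2 (le_triangle_sum p) (odd_sum_le_sqrt p)
  have hbound : ∀ N, n < N → |chordSeriesPowCoeff ℓ m n - 2 ^ (ℓ - 1) * catalan n * B *
      (ℓ * ((∑ j ∈ range N, (-1 : ℝ) ^ j * q ^ (j * (j + 1) / 2)) ^ (ℓ - 1) *
        ∑ j ∈ range N, (2 * (j : ℝ) + 1) * ((-1 : ℝ) ^ j * q ^ (j * (j + 1) / 2))))| ≤
      14400 * ℓ ^ 3 * 16 ^ ℓ / (n * s ^ (ℓ + 5)) * (B * catalan n) := fun N hN => by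
    rw [chordSeriesPowCoeff_eq_sum ℓ m (by omega) hN, ← sum_piFinset_main_term, mul_sum,
      ← sum_sub_distrib]
    refine (abs_sum_le_sum_abs _ _).trans ((sum_le_sum fun p _ => hterm p).trans ?_)
    rw [← mul_sum]
    calc _ ≤ 14400 * ℓ ^ 3 * 2 ^ ℓ / (n * s ^ 5) * (B * catalan n) * (8 / s) ^ ℓ := by
          gcongr
          exact sum_piFinset_exp_neg_triangle_le ℓ hs0 hs1 N
      _ = _ := by
          rw [show (16 : ℝ) = 2 * 8 by norm_num, mul_pow, div_pow, pow_add]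
          field_simp
  have hlim : Tendsto (fun N => |chordSeriesPowCoeff ℓ m n - 2 ^ (ℓ - 1) * catalan n * B *
      (ℓ * ((∑ j ∈ range N, (-1 : ℝ) ^ j * q ^ (j * (j + 1) / 2)) ^ (ℓ - 1) *
        ∑ j ∈ range N, (2 * (j : ℝ) + 1) * ((-1 : ℝ) ^ j * q ^ (j * (j + 1) / 2))))|) atTop
      (𝓝 |chordSeriesPowCoeff ℓ m n - 2 ^ (ℓ - 1) * catalan n * B *
        (ℓ * (altTriangularSeries q ^ (ℓ - 1) * eulerProductCubed q))|) := by
    refine (Tendsto.const_sub _ (Tendsto.const_mul _ (Tendsto.const_mul _ (Tendsto.mul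
      (Tendsto.pow (summable_altTriangular hq0 hq1).hasSum.tendsto_sum_nat _) ?_)))).abs
    rw [← tsum_odd_mul_pow_triangle hq0 hq1]
    exact (summable_jacobi hq0 hq1).hasSum.tendsto_sum_nat
  have hfin := le_of_tendsto hlim ((eventually_gt_atTop n).mono hbound)
  refine le_trans (le_of_eq ?_) hfin
  congr 2
  rw [mul_pow]
  ring

/-! ### The asymptotic equivalence -/

/-- The size of the main term, relative to `binom (n+m-1) (n-1) * catalan n`. -/
lemma le_main_term {q : ℝ} (hq0 : 0 ≤ q) (hq1 : q < 1) {ℓ : ℕ} (hℓ : 1 ≤ ℓ) :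
    (2 / 3) ^ ℓ * (Real.exp (-(Real.pi ^ 2 / (2 * (1 - q))) - 1) / √(1 - q) ^ 3) ≤
      ℓ * (2 * altTriangularSeries q) ^ (ℓ - 1) * eulerProductCubed q := by
  obtain ⟨P, hP, hle, -, -, heq⟩ := tendsto_qPochhammer hq0 hq1
  have hf := one_third_le_altTriangularSeries hq0 hq1
  have hδ : 0 < 1 - q := sub_pos.2 hq1
  have h1 : Real.exp (-(Real.pi ^ 2 / (2 * (1 - q))) - 1) / √(1 - q) ^ 3 ≤ P ^ 3 := by
    refine le_trans ?_ (pow_le_pow_left₀ (by positivity) hle 3)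
    rw [div_pow, ← Real.exp_nat_mul]
    gcongr
    have : Real.pi ^ 2 / (2 * (1 - q)) = 3 * (Real.pi ^ 2 / (6 * (1 - q))) := by field_simp; ring
    rw [this]; push_cast; linarith
  have h2 : (2 / 3 : ℝ) ^ ℓ ≤ ℓ * (2 * altTriangularSeries q) ^ (ℓ - 1) := by
    calc (2 / 3 : ℝ) ^ ℓ ≤ (2 / 3) ^ (ℓ - 1) :=
          pow_le_pow_of_le_one (by norm_num) (by norm_num) (Nat.sub_le _ _)
      _ ≤ (2 * altTriangularSeries q) ^ (ℓ - 1) :=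
          pow_le_pow_left₀ (by norm_num) (by linarith) _
      _ ≤ _ := by
          have : (1 : ℝ) ≤ ℓ := by exact_mod_cast hℓ
          exact le_mul_of_one_le_left (pow_nonneg (by linarith) _) this
  rw [heq]
  exact mul_le_mul h2 h1 (by positivity) (h2.trans' (by positivity))

/-- The hypothesis on `m`, in the form in which it is used: up to constants, the left-hand side is
the quotient of the error term by the main term. The power `√(log n)^(ℓ+2)` that the hypothesis
provides cancels `√(1 - q)^(-(ℓ+2))`. -/
lemma exp_div_pow_le {ℓ n m : ℕ} {w : ℝ} (hn : 3 ≤ n) (hw : 0 ≤ w)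
    (hm : (m : ℝ) ≤ 2 / Real.pi ^ 2 * (n : ℝ) *
        (Real.log n - 1 / 2 * ((ℓ : ℝ) + 2) * Real.log (Real.log n) - w)) :
    Real.exp (Real.pi ^ 2 / (2 * (1 - (m : ℝ) / (m + n)))) /
      (n * √(1 - (m : ℝ) / (m + n)) ^ (ℓ + 2)) ≤
      Real.exp (Real.pi ^ 2 / 2) * √2 ^ (ℓ + 2) * Real.exp (-w) := by
  have hn0 : (0 : ℝ) < n := by positivity
  set L := Real.log n with hL
  have hL1 : 1 ≤ L := by
    rw [hL, Real.le_log_iff_exp_le hn0]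
    have : (3 : ℝ) ≤ n := by exact_mod_cast hn
    linarith [Real.exp_one_lt_d9]
  have hLL : 0 ≤ Real.log L := Real.log_nonneg hL1
  have hpi : 2 ≤ Real.pi ^ 2 := by nlinarith [Real.pi_gt_three]
  have hd : 1 - (m : ℝ) / (m + n) = n / (m + n) := by field_simp; ring
  have hinv : 1 / (1 - (m : ℝ) / (m + n)) = 1 + m / n := by rw [hd]; field_simp; ring
  have hX : Real.pi ^ 2 / 2 * ((m : ℝ) / n) ≤ L - 1 / 2 * ((ℓ : ℝ) + 2) * Real.log L - w := by
    have h2 : (m : ℝ) / n ≤ 2 / Real.pi ^ 2 *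
        (L - 1 / 2 * ((ℓ : ℝ) + 2) * Real.log L - w) := by
      rw [div_le_iff₀ hn0]; linarith
    calc Real.pi ^ 2 / 2 * ((m : ℝ) / n) ≤ Real.pi ^ 2 / 2 * (2 / Real.pi ^ 2 *
        (L - 1 / 2 * ((ℓ : ℝ) + 2) * Real.log L - w)) := by gcongr
      _ = _ := by field_simp
  have hmn : (m : ℝ) / n ≤ L := by
    have h3 : (m : ℝ) / n ≤ Real.pi ^ 2 / 2 * ((m : ℝ) / n) :=
      le_mul_of_one_le_left (by positivity) (by linarith)
    have h4 : 0 ≤ 1 / 2 * ((ℓ : ℝ) + 2) * Real.log L := by positivity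
    linarith
  have hexp : Real.exp (Real.pi ^ 2 / (2 * (1 - (m : ℝ) / (m + n)))) ≤
      Real.exp (Real.pi ^ 2 / 2) * (n / √L ^ (ℓ + 2) * Real.exp (-w)) := by
    have h5 : Real.pi ^ 2 / (2 * (1 - (m : ℝ) / (m + n))) =
        Real.pi ^ 2 / 2 + Real.pi ^ 2 / 2 * (m / n) := by
      calc _ = Real.pi ^ 2 / 2 * (1 / (1 - (m : ℝ) / (m + n))) := by rw [div_mul_div_comm, mul_one]
        _ = _ := by rw [hinv]; ring
    have h6 : √L ^ (ℓ + 2) = Real.exp (1 / 2 * ((ℓ : ℝ) + 2) * Real.log L) := by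
      rw [Real.sqrt_eq_rpow, ← Real.rpow_natCast, ← Real.rpow_mul (by linarith),
        Real.rpow_def_of_pos (by linarith)]
      congr 1; push_cast; ring
    rw [h5, Real.exp_add, h6]
    gcongr
    calc _ ≤ Real.exp (L - 1 / 2 * ((ℓ : ℝ) + 2) * Real.log L - w) := Real.exp_le_exp.2 hX
      _ = _ := by rw [sub_eq_add_neg _ w, Real.exp_add, Real.exp_sub, hL, Real.exp_log hn0]
  have hsq : 1 / √(1 - (m : ℝ) / (m + n)) ≤ √2 * √L := by
    have h7 : 1 / √(1 - (m : ℝ) / (m + n)) = √(1 + m / n) := by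
      rw [← hinv, Real.sqrt_div zero_le_one, Real.sqrt_one]
    rw [h7, ← Real.sqrt_mul zero_le_two]
    exact Real.sqrt_le_sqrt (by linarith)
  have hLpos : 0 < √L := Real.sqrt_pos.2 (by linarith)
  have hspos : 0 < √(1 - (m : ℝ) / (m + n)) := by rw [hd]; positivity
  calc _ = Real.exp (Real.pi ^ 2 / (2 * (1 - (m : ℝ) / (m + n)))) *
        (1 / √(1 - (m : ℝ) / (m + n))) ^ (ℓ + 2) / n := by rw [div_pow, one_pow]; field_simp
    _ ≤ Real.exp (Real.pi ^ 2 / 2) * (n / √L ^ (ℓ + 2) * Real.exp (-w)) *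
        (√2 * √L) ^ (ℓ + 2) / n := by gcongr
    _ = _ := by rw [mul_pow]; field_simp

lemma numChordDiagrams_eq (n m : ℕ) :
    (numChordDiagrams n m : ℝ) = chordSeriesPowCoeff 1 m n := by
  simp [chordSeriesPowCoeff, chordSeries]

theorem chordSeriesPowCoeff_isEquivalent {ℓ : ℕ} (hℓ : 1 ≤ ℓ) {ω : ℕ → ℝ}
    (hω : Tendsto ω atTop atTop) {m : ℕ → ℕ}
    (hm : ∀ᶠ n : ℕ in atTop, (m n : ℝ) ≤ 2 / Real.pi ^ 2 * (n : ℝ) *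
      (Real.log n - 1 / 2 * ((ℓ : ℝ) + 2) * Real.log (Real.log n) - ω n))
    {q : ℕ → ℝ} (hq : ∀ n, q n = (m n : ℝ) / ((m n : ℝ) + (n : ℝ))) :
    Asymptotics.IsEquivalent atTop (fun n : ℕ => chordSeriesPowCoeff ℓ (m n) n)
      (fun n : ℕ => (ℓ : ℝ) * (2 * altTriangularSeries (q n)) ^ (ℓ - 1) *
        (Nat.choose (n + m n - 1) (n - 1) : ℝ) * (catalan n : ℝ) * eulerProductCubed (q n)) := by
  set D : ℝ := 14400 * ℓ ^ 3 * 16 ^ ℓ * (3 / 2) ^ ℓ * Real.exp 1 *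
    (Real.exp (Real.pi ^ 2 / 2) * √2 ^ (ℓ + 2)) with hD
  have hlim : Tendsto (fun n => D * Real.exp (-ω n)) atTop (𝓝 0) := by
    have := (Real.tendsto_exp_neg_atTop_nhds_zero.comp hω).const_mul D
    simpa using this
  rw [Asymptotics.IsEquivalent, Asymptotics.isLittleO_iff]
  intro c hc
  filter_upwards [hm, hω.eventually_ge_atTop 0, eventually_ge_atTop 3,
    hlim.eventually_le_const hc] with n hmn hωn hn hcn
  have herr := abs_chordSeriesPowCoeff_sub_le hℓ (show 2 ≤ n by omega) (m n)
  have hcond := exp_div_pow_le hn hωn hmn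
  have hn0 : (0 : ℝ) < n := by positivity
  have hq0 : 0 ≤ q n := by rw [hq]; positivity
  have hq1 : q n < 1 := by rw [hq]; exact (div_lt_one (by positivity)).2 (by linarith)
  have hmain := le_main_term hq0 hq1 hℓ
  rw [← hq] at herr hcond
  set s := √(1 - q n) with hs
  have hs0 : 0 < s := Real.sqrt_pos.2 (sub_pos.2 hq1)
  set G : ℝ := ((n + m n - 1).choose (n - 1) : ℝ) * catalan n with hG
  have hG0 : 0 ≤ G := by positivity
  set M := ℓ * (2 * altTriangularSeries (q n)) ^ (ℓ - 1) * eulerProductCubed (q n) with hM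
  have hMG : (ℓ : ℝ) * (2 * altTriangularSeries (q n)) ^ (ℓ - 1) *
      (Nat.choose (n + m n - 1) (n - 1) : ℝ) * (catalan n : ℝ) * eulerProductCubed (q n) =
      M * G := by rw [hM, hG]; ring
  have hM0 : 0 < M := lt_of_lt_of_le (by positivity) hmain
  simp only [Pi.sub_apply, Real.norm_eq_abs]
  rw [hMG] at herr ⊢
  rw [abs_of_nonneg (mul_nonneg hM0.le hG0), ← mul_assoc c M G]
  refine herr.trans (mul_le_mul_of_nonneg_right ?_ hG0)
  refine le_trans ?_ (mul_le_mul_of_nonneg_right hcn hM0.le)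
  set E := Real.exp (Real.pi ^ 2 / (2 * (1 - q n))) with hE
  have hE0 : 0 < E := Real.exp_pos _
  have hE1 : Real.exp (-(Real.pi ^ 2 / (2 * (1 - q n))) - 1) = 1 / (E * Real.exp 1) := by
    rw [← neg_add', Real.exp_neg, Real.exp_add, one_div]
  rw [hE1] at hmain
  -- the error term is rewritten as a multiple of the lower bound for the main term
  calc 14400 * (ℓ : ℝ) ^ 3 * 16 ^ ℓ / (n * s ^ (ℓ + 5))
      = 14400 * ℓ ^ 3 * 16 ^ ℓ * (3 / 2) ^ ℓ * Real.exp 1 * (E / (n * s ^ (ℓ + 2))) *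
        ((2 / 3) ^ ℓ * (1 / (E * Real.exp 1) / s ^ 3)) := by
        have h1 : (3 / 2 : ℝ) ^ ℓ * (2 / 3) ^ ℓ = 1 := by rw [← mul_pow]; norm_num
        have h2 : s ^ (ℓ + 5) = s ^ (ℓ + 2) * s ^ 3 := by rw [← pow_add]
        calc _ = 14400 * (ℓ : ℝ) ^ 3 * 16 ^ ℓ / (n * (s ^ (ℓ + 2) * s ^ 3)) *
              ((3 / 2 : ℝ) ^ ℓ * (2 / 3) ^ ℓ) * (E / E) *
                (Real.exp 1 / Real.exp 1) := by
              rw [h1, h2, div_self hE0.ne', div_self (Real.exp_pos 1).ne']; ring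
          _ = _ := by
              simp only [div_eq_mul_inv, mul_inv]; ring
    _ ≤ 14400 * ℓ ^ 3 * 16 ^ ℓ * (3 / 2) ^ ℓ * Real.exp 1 *
        (Real.exp (Real.pi ^ 2 / 2) * √2 ^ (ℓ + 2) * Real.exp (-ω n)) * M := by gcongr
    _ = D * Real.exp (-ω n) * M := by rw [hD]; ring

end

theorem mainTheorem4 (ℓ : ℕ) (hℓ : 1 ≤ ℓ)
    (ω : ℕ → ℝ) (hω : Filter.Tendsto ω Filter.atTop Filter.atTop)
    (m : ℕ → ℕ)
    (hm : ∀ᶠ n : ℕ in Filter.atTop,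
      (m n : ℝ) ≤ 2 / Real.pi ^ 2 * (n : ℝ) *
        (Real.log n - 1 / 2 * ((ℓ : ℝ) + 2) * Real.log (Real.log n) - ω n))
    (q : ℕ → ℝ) (hq : ∀ n, q n = (m n : ℝ) / ((m n : ℝ) + (n : ℝ))) :
    Asymptotics.IsEquivalent Filter.atTop
      (fun n : ℕ => chordSeriesPowCoeff ℓ (m n) n)
      (fun n : ℕ => (ℓ : ℝ) * (2 * altTriangularSeries (q n)) ^ (ℓ - 1) *
        (Nat.choose (n + m n - 1) (n - 1) : ℝ) * (catalan n : ℝ) * eulerProductCubed (q n)) ∧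
    (ℓ = 1 → Asymptotics.IsEquivalent Filter.atTop
      (fun n : ℕ => (numChordDiagrams n (m n) : ℝ))
      (fun n : ℕ => (Nat.choose (n + m n - 1) (n - 1) : ℝ) * (catalan n : ℝ) *
        eulerProductCubed (q n))) := by
  have main := chordSeriesPowCoeff_isEquivalent hℓ hω hm hq
  refine ⟨main, ?_⟩
  rintro rfl
  simpa [numChordDiagrams_eq] using main
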